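/- **Setting.** Let $R$ be a commutative ring and let $\mathcal S_*$ be the category of pointed simplicial sets. The cardinality $|K|$ of a simplicial set $K$ is the cardinality of the set of all its simplices. A simplicial $R$-module is regarded as a pointed simplicial set with base point $0$. For $K\in\mathcal S_*$ let $PK\subseteq K^{\Delta[1]}$ be the path object (the fibre of evaluation at the vertex $0$ over the base point), let $p_K:PK\to K$ be evaluation at the vertex $1$, and let $CK=(K\times\Delta[1])/(K\times\{0\}\cup *\times\Delta[1])$ be the reduced cone, so that maps $\Phi:K\to PL$ have adjoints $\widetilde\Phi:CK\to L$. For a simplicial $R$-module $M$ and a map $f:K\to M$ in $\mathcal S_*$, let $\widehat{\mathrm{Im}}(f)$ be the smallest simplicial submodule of $M$ containing the image of $f$; $f$ is an *effective epimorphism* if $\widehat{\mathrm{Im}}(f)=M$. For $\Phi:K\to PM$ put $\widehat{\widehat{\mathrm{Im}}}(\Phi)=P(\widehat{\mathrm{Im}}(\widetilde\Phi))$; $\Phi$ is *effectively surjective* if $\widehat{\mathrm{Im}}(\widetilde\Phi)=M$. Let $$\lambda_X=\sup_M\bigl(\{|\widehat{\mathrm{Im}}(\phi)| : \phi:X\to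 M\}\cup\{|\widehat{\widehat{\mathrm{Im}}}(\Phi)| : \Phi:X\to PM\}\bigr),$$ where $M$ runs over all simplicial $R$-modules. **The modified dual Stover construction.** For an effective epimorphism $\phi:X\to M$ let $\widehat Q_\phi$ be the pullback in $\mathcal S_*$ of $$M\xrightarrow{(j)}\prod_{(j,\Phi)}M'\xleftarrow{\ \prod p_{M'}\ }\prod_{(j,\Phi)}PM',$$ where $(j,\Phi)$ runs over the pairs consisting of a monomorphism $j:M\to M'$ of simplicial $R$-modules and an effectively surjective $\Phi:X\to PM'$ with $p_{M'}\Phi=j\phi$, one from each isomorphism class (isomorphisms $\alpha:M'\cong M''$ with $\alpha j=j'$ and $P\alpha\circ\Phi=\Phi'$). Put $$\widehat{\mathcal T}_RX=\prod_{\phi}\widehat Q_\phi,$$ where $\phi:X\to M$ runs over the effective epimorphisms from $X$ to simplicial $R$-modules, one from each isomorphism class (isomorphisms $\alpha:M\cong M'$ with $\alpha\phi=\phi'$). There is only a set of such classes in both cases. **The bounded monad.** For a cardinal $\lambda$ let $\mathcal M_\lambda$ be a small category equivalent to the category of simplicial $R$-modules of cardinality at most $\lambda$ and their monomorphisms. Let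 $L_\lambda$ be the functor from $\mathcal S_*$ to the opposite of the category of functors from $\mathcal M_\lambda$ to arrows of pointed sets, with $$L_\lambda(Y)(M)=\bigl((p_M)_*:\mathrm{Hom}_{\mathcal S_*}(Y,PM)\to\mathrm{Hom}_{\mathcal S_*}(Y,M)\bigr).$$ It has a right adjoint $R_\lambda$, and $\mathcal T_R^\lambda=R_\lambda L_\lambda$ is the resulting monad on $\mathcal S_*$. The limit $\mathcal T_R^\lambda X$ has a projection to $N$ for each $\varphi:X\to N$ and one to $PN$ for each $\Psi:X\to PN$, with $N\in\mathcal M_\lambda$. **Proposition.** For every pointed simplicial set $X$ and every cardinal $\lambda\ge\lambda_X$ there is a canonical isomorphism $$\widehat{\mathcal T}_RX\;\cong\;\mathcal T_R^\lambda X$$ of pointed simplicial sets. It is the unique isomorphism with the following two properties, for every index $\phi:X\to M$ and every $N\in\mathcal M_\lambda$: for every monomorphism $i:M\to N$, its composite with the projection indexed by $i\phi$ is $\widehat{\mathcal T}_RX\to\widehat Q_\phi\to M\xrightarrow{i}N$; and for every index $(j:M\to M',\Phi)$ and every monomorphism $l:M'\to N$, its composite with the projection indexed by $Pl\circ\Phi$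 is $\widehat{\mathcal T}_RX\to\widehat Q_\phi\to PM'\xrightarrow{Pl}PN$. -/

import Mathlib

open CategoryTheory MonoidalCategory Simplicial Opposite

universe u

namespace DualStover

noncomputable section

/-! ### Pointed simplicial sets and simplicial modules -/

/-- The category of pointed simplicial sets, as simplicial objects in pointed sets. -/
abbrev PSSet : Type (u + 1) := SimplexCategoryᵒᵖ ⥤ Pointed.{u}

/-- The category of simplicial `R`-modules. -/
abbrev SMod (R : Type u) [CommRing R] : Type (u + 1) :=
  SimplexCategoryᵒᵖ ⥤ ModuleCat.{u} R

/-- The set of all simplices of a pointed simplicial set. Its cardinality is what is meant by the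
cardinality of a simplicial set. -/
abbrev Simplices (X : PSSet.{u}) : Type u := Σ n : SimplexCategoryᵒᵖ, (X.obj n).X

/-- The underlying (unpointed) simplicial set. -/
abbrev toSSet : PSSet.{u} ⥤ SSet.{u} :=
  (Functor.whiskeringRight _ _ _).obj (forget Pointed.{u})

/-- The underlying pointed set `(M, 0)` of a module. -/
@[simps]
def modToPointed (R : Type u) [CommRing R] : ModuleCat.{u} R ⥤ Pointed.{u} where
  obj M := ⟨M, 0⟩
  map f := ⟨f.hom, map_zero _⟩

/-- The underlying pointed simplicial set of a simplicial `R`-module. -/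
abbrev toPSSet (R : Type u) [CommRing R] : SMod R ⥤ PSSet.{u} :=
  (Functor.whiskeringRight _ _ _).obj (modToPointed R)

/-- The base vertex. -/
def baseVertex (X : PSSet.{u}) : (toSSet.obj X) _⦋0⦌ := (X.obj (op ⦋0⦌)).point

/-- The constant map to the base point. -/
def constMap (K : SSet.{u}) (X : PSSet.{u}) : K ⟶ toSSet.obj X := SSet.const (baseVertex X)

lemma map_point (X : PSSet.{u}) {m n : SimplexCategoryᵒᵖ} (f : m ⟶ n) :
    (X.map f).toFun (X.obj m).point = (X.obj n).point := (X.map f).map_point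

/-- The zero map between pointed simplicial sets. -/
def zeroMap (X Y : PSSet.{u}) : X ⟶ Y where
  app n := ⟨fun _ => (Y.obj n).point, rfl⟩
  naturality m n f := by
    apply Pointed.Hom.ext
    funext x
    exact (map_point Y f).symm

/-! ### Path objects and cones -/

lemma constMap_map (K : SSet.{u}) {X Y : PSSet.{u}} (f : X ⟶ Y) :
    constMap K X ≫ toSSet.map f = constMap K Y := by
  have h : (toSSet.map f).app (op ⦋0⦌) (baseVertex X) = baseVertex Y :=
    (f.app (op ⦋0⦌)).map_point
  rw [constMap, SSet.const_comp, h, constMap]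

lemma comp_constMap {K L : SSet.{u}} (g : K ⟶ L) (X : PSSet.{u}) :
    g ≫ constMap L X = constMap K X := SSet.comp_const _ _

/-- The pointed path object `P X`: the `n`-simplices are the maps `Δ[n] × Δ[1] ⟶ X`, i.e. the
`n`-simplices of `X ^ Δ[1]`, whose restriction along the vertex `0` of `Δ[1]` is constant at the
base point. -/
def pathObj (X : PSSet.{u}) : PSSet.{u} where
  obj n := ⟨{h : SSet.stdSimplex.{u}.obj n.unop ⊗ Δ[1] ⟶ toSSet.obj X //
      SSet.ι₀ ≫ h = constMap _ X}, ⟨constMap _ X, comp_constMap _ _⟩⟩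
  map f := ⟨fun h => ⟨(SSet.stdSimplex.map f.unop ▷ Δ[1]) ≫ h.1, by
      rw [← Category.assoc, SSet.ι₀_comp, Category.assoc, h.2, comp_constMap]⟩,
    Subtype.ext (comp_constMap _ _)⟩
  map_id n := by
    apply Pointed.Hom.ext
    funext h
    apply Subtype.ext
    change (SSet.stdSimplex.map (𝟙 n.unop) ▷ Δ[1]) ≫ h.1 = h.1
    rw [show SSet.stdSimplex.map (𝟙 n.unop) = 𝟙 (SSet.stdSimplex.{u}.obj n.unop) from
      CategoryTheory.Functor.map_id _ _, id_whiskerRight, Category.id_comp]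
  map_comp f g := by
    apply Pointed.Hom.ext
    funext h
    apply Subtype.ext
    change (SSet.stdSimplex.map (g.unop ≫ f.unop) ▷ Δ[1]) ≫ h.1
      = (SSet.stdSimplex.map g.unop ▷ Δ[1]) ≫ (SSet.stdSimplex.map f.unop ▷ Δ[1]) ≫ h.1
    rw [show SSet.stdSimplex.{u}.map (g.unop ≫ f.unop)
      = SSet.stdSimplex.map g.unop ≫ SSet.stdSimplex.map f.unop from
      CategoryTheory.Functor.map_comp _ _ _, comp_whiskerRight, Category.assoc]

/-- The map `P f : P X ⟶ P Y`. -/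
def pathMap {X Y : PSSet.{u}} (f : X ⟶ Y) : pathObj X ⟶ pathObj Y where
  app n := ⟨fun h => ⟨h.1 ≫ toSSet.map f, by
      rw [← Category.assoc, h.2, constMap_map]⟩,
    Subtype.ext (constMap_map _ _)⟩
  naturality m n g := by
    apply Pointed.Hom.ext
    funext h
    apply Subtype.ext
    exact Category.assoc (SSet.stdSimplex.map g.unop ▷ Δ[1]) h.1 (toSSet.map f)

lemma pathMap_id (X : PSSet.{u}) : pathMap (𝟙 X) = 𝟙 (pathObj X) := rfl

lemma pathMap_comp {X Y Z : PSSet.{u}} (f : X ⟶ Y) (g : Y ⟶ Z) :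
    pathMap (f ≫ g) = pathMap f ≫ pathMap g := rfl

/-- The path functor `P` on pointed simplicial sets. -/
@[simps]
def pathFunctor : PSSet.{u} ⥤ PSSet.{u} where
  obj := pathObj
  map := pathMap

/-- The path fibration `p : P X ⟶ X`, given by evaluation at the vertex `1` of `Δ[1]`. -/
def pathEnd (X : PSSet.{u}) : pathObj X ⟶ X where
  app n := ⟨fun h => SSet.yonedaEquiv (SSet.ι₁ ≫ h.1), by
    change SSet.yonedaEquiv (SSet.ι₁ ≫ constMap _ X) = _
    rw [comp_constMap]
    exact map_point X _⟩
  naturality m n g := by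
    apply Pointed.Hom.ext
    funext h
    change SSet.yonedaEquiv (SSet.ι₁ ≫ (SSet.stdSimplex.map g.unop ▷ Δ[1]) ≫ h.1)
      = (toSSet.obj X).map g (SSet.yonedaEquiv (SSet.ι₁ ≫ h.1))
    rw [← Category.assoc, SSet.ι₁_comp, Category.assoc]
    exact (SSet.yonedaEquiv_naturality g.unop (SSet.ι₁ ≫ h.1)).symm

lemma pathMap_pathEnd {X Y : PSSet.{u}} (f : X ⟶ Y) :
    pathMap f ≫ pathEnd Y = pathEnd X ≫ f := by
  apply NatTrans.ext
  funext n
  apply Pointed.Hom.ext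
  funext h
  change SSet.yonedaEquiv (SSet.ι₁ ≫ h.1 ≫ toSSet.map f)
    = (toSSet.map f).app n (SSet.yonedaEquiv (SSet.ι₁ ≫ h.1))
  rw [← Category.assoc, SSet.yonedaEquiv_comp]

/-- The simplices of the cylinder `X × Δ[1]` which are collapsed in the cone on `X`: those over
the base point of `X`, and those over the vertex `0` of `Δ[1]`. -/
def Collapsed (X : PSSet.{u}) (n : SimplexCategoryᵒᵖ) (a : (toSSet.obj X ⊗ Δ[1]).obj n) : Prop :=
  a.1 = (X.obj n).point ∨ a = SSet.ι₀.app n a.1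

lemma Collapsed.map {X : PSSet.{u}} {m n : SimplexCategoryᵒᵖ} (g : m ⟶ n)
    {a : (toSSet.obj X ⊗ Δ[1]).obj m} (ha : Collapsed X m a) :
    Collapsed X n ((toSSet.obj X ⊗ Δ[1]).map g a) := by
  rcases ha with ha | ha
  · left
    change (X.map g).toFun a.1 = _
    rw [ha, map_point]
  · right
    have h := NatTrans.naturality_apply (SSet.ι₀ (X := toSSet.obj X)) g a.1
    rw [← ha] at h
    rw [← h]
    rfl

/-- Two simplices of the cylinder are identified in the cone if they are equal or both
collapsed. -/
def coneSetoid (X : PSSet.{u}) (n : SimplexCategoryᵒᵖ) :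
    Setoid ((toSSet.obj X ⊗ Δ[1]).obj n) where
  r a b := a = b ∨ (Collapsed X n a ∧ Collapsed X n b)
  iseqv :=
    { refl := fun _ => Or.inl rfl
      symm := by
        rintro a b (h | h)
        · exact Or.inl h.symm
        · exact Or.inr h.symm
      trans := by
        rintro a b c (rfl | h) (rfl | h')
        · exact Or.inl rfl
        · exact Or.inr h'
        · exact Or.inr h
        · exact Or.inr ⟨h.1, h'.2⟩ }

/-- The reduced cone `C X = (X × Δ[1]) / (X × {0} ∪ * × Δ[1])`. -/
def coneObj (X : PSSet.{u}) : PSSet.{u} where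
  obj n := ⟨Quotient (coneSetoid X n),
    Quotient.mk (coneSetoid X n) (SSet.ι₀.app n (X.obj n).point)⟩
  map {m n} g := ⟨Quotient.map' ((toSSet.obj X ⊗ Δ[1]).map g) (by
      rintro a b (rfl | h)
      · exact Or.inl rfl
      · exact Or.inr ⟨h.1.map g, h.2.map g⟩), by
    apply Quotient.sound
    exact Or.inr ⟨Collapsed.map g (Or.inl rfl), Or.inl rfl⟩⟩
  map_id n := by
    apply Pointed.Hom.ext
    funext q
    induction q using Quotient.inductionOn with
    | h a =>
      exact congrArg (Quotient.mk (coneSetoid X _))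
        (Functor.map_id_apply (toSSet.obj X ⊗ Δ[1] : SSet.{u}) n a)
  map_comp f g := by
    apply Pointed.Hom.ext
    funext q
    induction q using Quotient.inductionOn with
    | h a =>
      exact congrArg (Quotient.mk (coneSetoid X _))
        (Functor.map_comp_apply (toSSet.obj X ⊗ Δ[1] : SSet.{u}) f g a)

/-- The map `C X ⟶ Y` adjoint to a map `Φ : X ⟶ P Y`; it sends the class of `(x, t)` to
`Φ x (id, t)`. -/
def coneAdj {X Y : PSSet.{u}} (Φ : X ⟶ pathObj Y) : coneObj X ⟶ Y where
  app n := ⟨Quotient.lift (s := coneSetoid X n)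
      (fun a => ((Φ.app n).toFun a.1).1.app n
        (SSet.stdSimplex.objEquiv.symm (𝟙 n.unop), a.2)) (by
      have key : ∀ a : (toSSet.obj X ⊗ Δ[1]).obj n, Collapsed X n a →
          ((Φ.app n).toFun a.1).1.app n (SSet.stdSimplex.objEquiv.symm (𝟙 n.unop), a.2)
            = (Y.obj n).point := by
        rintro a (ha | ha)
        · rw [ha, (Φ.app n).map_point]
          exact map_point Y _
        · have h := ((Φ.app n).toFun a.1).2
          have h' := NatTrans.congr_app h n
          have h'' := ConcreteCategory.congr_hom h' (SSet.stdSimplex.objEquiv.symm (𝟙 n.unop))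
          have h3 : (SSet.stdSimplex.objEquiv.symm (𝟙 n.unop), a.2)
            = SSet.ι₀.app n (SSet.stdSimplex.objEquiv.symm (𝟙 n.unop)) := by
            refine Prod.ext rfl ?_
            have h4 : a.2 = (SSet.ι₀.app n a.1).2 := congrArg Prod.snd ha
            exact h4
          rw [h3]
          exact h''.trans (map_point Y _)
      rintro a b (rfl | h)
      · rfl
      · rw [key a h.1, key b h.2]), by
    change ((Φ.app n).toFun (X.obj n).point).1.app n _ = _
    rw [(Φ.app n).map_point]
    exact map_point Y _⟩
  naturality m n g := by
    apply Pointed.Hom.ext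
    funext q
    induction q using Quotient.inductionOn with
    | h a =>
      change ((Φ.app n).toFun ((X.map g).toFun a.1)).1.app n
          (SSet.stdSimplex.objEquiv.symm (𝟙 n.unop), Δ[1].map g a.2)
        = (toSSet.obj Y).map g (((Φ.app m).toFun a.1).1.app m
          (SSet.stdSimplex.objEquiv.symm (𝟙 m.unop), a.2))
      have h1 : (Φ.app n).toFun ((X.map g).toFun a.1)
          = ((pathObj Y).map g).toFun ((Φ.app m).toFun a.1) :=
        congrFun (congrArg Pointed.Hom.toFun (Φ.naturality g)) a.1
      rw [h1]
      have h2 := NatTrans.naturality_apply ((Φ.app m).toFun a.1).1 g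
        ((SSet.stdSimplex.objEquiv.symm (𝟙 m.unop), a.2) :
          (SSet.stdSimplex.obj m.unop ⊗ Δ[1] : SSet.{u}).obj m)
      refine Eq.trans ?_ h2
      change ((Φ.app m).toFun a.1).1.app n
        ((SSet.stdSimplex.map g.unop).app n (SSet.stdSimplex.objEquiv.symm (𝟙 n.unop)),
          Δ[1].map g a.2) = _
      congr 1

/-- The inclusion of `X` in its cone, at the vertex `1`. -/
def coneIncl (X : PSSet.{u}) : X ⟶ coneObj X where
  app n := ⟨fun x => Quotient.mk (coneSetoid X n) (SSet.ι₁.app n x),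
    Quotient.sound (Or.inr ⟨Or.inl rfl, Or.inl rfl⟩)⟩
  naturality m n g := by
    apply Pointed.Hom.ext
    funext x
    exact congrArg (Quotient.mk (coneSetoid X n))
      (NatTrans.naturality_apply (SSet.ι₁ (X := toSSet.obj X)) g x)

lemma coneIncl_coneAdj {X Y : PSSet.{u}} (Φ : X ⟶ pathObj Y) :
    coneIncl X ≫ coneAdj Φ = Φ ≫ pathEnd Y := rfl

/-! ### Simplicial submodules, effective epimorphisms and effectively surjective nullhomotopies -/

section Submodules

variable {R : Type u} [CommRing R]

/-- A simplicial submodule of a simplicial module. -/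
structure SimplicialSubmodule (M : SMod R) where
  /-- the submodule of `n`-simplices -/
  obj (n : SimplexCategoryᵒᵖ) : Submodule R (M.obj n)
  map_mem {m n : SimplexCategoryᵒᵖ} (g : m ⟶ n) {x : M.obj m} (hx : x ∈ obj m) :
    M.map g x ∈ obj n

/-- A simplicial submodule, as a simplicial module. -/
def SimplicialSubmodule.toSMod {M : SMod R} (N : SimplicialSubmodule M) : SMod R where
  obj n := ModuleCat.of R (N.obj n)
  map g := ModuleCat.ofHom ((M.map g).hom.restrict fun _ hx => N.map_mem g hx)
  map_id n := by
    ext x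
    exact ConcreteCategory.congr_hom (M.map_id n) x.1
  map_comp f g := by
    ext x
    exact ConcreteCategory.congr_hom (M.map_comp f g) x.1

/-- The smallest simplicial submodule of `M` containing the image of `f : X ⟶ M`. -/
def hIm {X : PSSet.{u}} {M : SMod R} (f : X ⟶ (toPSSet R).obj M) : SimplicialSubmodule M where
  obj n := sInf {S | ∃ N : SimplicialSubmodule M,
    (∀ (k : SimplexCategoryᵒᵖ) (x : (X.obj k).X), (f.app k).toFun x ∈ N.obj k) ∧ N.obj n = S}
  map_mem {m n} g x hx := by
    rw [Submodule.mem_sInf] at hx ⊢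
    rintro _ ⟨N, hN, rfl⟩
    exact N.map_mem g (hx _ ⟨N, hN, rfl⟩)

/-- The map `f : X ⟶ M` is an effective epimorphism if its image generates the simplicial
module `M`. -/
def IsEffEpi {X : PSSet.{u}} {M : SMod R} (f : X ⟶ (toPSSet R).obj M) : Prop :=
  ∀ n, (hIm f).obj n = ⊤

/-- The nullhomotopy `Φ : X ⟶ P M` is effectively surjective if the image of the adjoint map
`C X ⟶ M` generates the simplicial module `M`. -/
def IsEffSurj {X : PSSet.{u}} {M : SMod R} (Φ : X ⟶ pathObj ((toPSSet R).obj M)) : Prop :=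
  IsEffEpi (coneAdj Φ)

/-- The image of `f : X ⟶ M` on `n`-simplices. -/
def levelImage {X : PSSet.{u}} {M : SMod R} (f : X ⟶ (toPSSet R).obj M)
    (n : SimplexCategoryᵒᵖ) : Set (M.obj n) := {x | ∃ y, (f.app n).toFun y = x}

lemma hIm_obj {X : PSSet.{u}} {M : SMod R} (f : X ⟶ (toPSSet R).obj M)
    (n : SimplexCategoryᵒᵖ) : (hIm f).obj n = Submodule.span R (levelImage f n) := by
  apply le_antisymm
  · refine sInf_le ⟨⟨fun k => Submodule.span R (levelImage f k), ?_⟩, ?_, rfl⟩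
    · intro m n g x hx
      induction hx using Submodule.span_induction with
      | mem x h =>
        obtain ⟨y, rfl⟩ := h
        refine Submodule.subset_span ⟨(X.map g).toFun y, ?_⟩
        exact congrFun (congrArg Pointed.Hom.toFun (f.naturality g)) y
      | zero => simp
      | add x y _ _ hx hy => simpa using Submodule.add_mem _ hx hy
      | smul a x _ hx => simpa using Submodule.smul_mem _ a hx
    · exact fun k x => Submodule.subset_span ⟨x, rfl⟩
  · refine le_sInf ?_
    rintro _ ⟨N, hN, rfl⟩
    rw [Submodule.span_le]
    rintro _ ⟨x, rfl⟩
    exact hN n x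

end Submodules

/-! ### A small category of bounded simplicial modules -/

section Bounded

variable (R : Type u) [CommRing R] (κ : Cardinal.{u})

/-- A simplicial `R`-module with at most `κ` simplices, whose sets of `n`-simplices are subsets
of a fixed set of cardinality `κ`. -/
structure BddMod : Type u where
  /-- the set of `n`-simplices -/
  carrier : SimplexCategoryᵒᵖ → Set κ.out
  [grp : ∀ n, AddCommGroup (carrier n)]
  [mod : ∀ n, Module R (carrier n)]
  /-- the simplicial operators -/
  map : ∀ {m n : SimplexCategoryᵒᵖ}, (m ⟶ n) → (carrier m →ₗ[R] carrier n)
  map_id : ∀ n, map (𝟙 n) = LinearMap.id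
  map_comp : ∀ {l m n : SimplexCategoryᵒᵖ} (f : l ⟶ m) (g : m ⟶ n),
    map (f ≫ g) = map g ∘ₗ map f
  card_le : Cardinal.mk (Σ n, carrier n) ≤ κ

attribute [instance] BddMod.grp BddMod.mod

variable {R κ}

/-- The simplicial module given by an object of `BddMod R κ`. -/
def BddMod.toSMod (N : BddMod R κ) : SMod R where
  obj n := ModuleCat.of R (N.carrier n)
  map g := ModuleCat.ofHom (N.map g)
  map_id n := by rw [N.map_id]; rfl
  map_comp f g := by rw [N.map_comp]; rfl

/-- The morphisms of the category of bounded simplicial modules are the monomorphisms. -/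
instance : Category.{u} (BddMod R κ) where
  Hom N N' := {j : N.toSMod ⟶ N'.toSMod // Mono j}
  id N := ⟨𝟙 _, inferInstance⟩
  comp f g := ⟨f.1 ≫ g.1, haveI := f.2; haveI := g.2; mono_comp _ _⟩

/-- Every simplicial `R`-module with at most `κ` simplices is isomorphic to an object of
`BddMod R κ`. -/
lemma BddMod.exists_iso (M : SMod R)
    (hM : Cardinal.mk (Simplices ((toPSSet R).obj M)) ≤ κ) :
    ∃ N : BddMod R κ, Nonempty (M ≅ N.toSMod) := by
  have hle : Cardinal.mk (Simplices ((toPSSet R).obj M)) ≤ Cardinal.mk κ.out := by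
    rwa [Cardinal.mk_out]
  obtain ⟨ε⟩ := hle
  let i : ∀ n, M.obj n → κ.out := fun n x => ε ⟨n, x⟩
  have hi : ∀ n, Function.Injective (i n) := by
    intro n x y h
    exact eq_of_heq (Sigma.mk.inj (ε.injective h)).2
  let e : ∀ n, M.obj n ≃ Set.range (i n) := fun n => Equiv.ofInjective (i n) (hi n)
  let g : ∀ n, AddCommGroup (Set.range (i n)) := fun n => (e n).symm.addCommGroup
  let md : ∀ n, Module R (Set.range (i n)) := fun n => (e n).symm.module R
  let l : ∀ n, M.obj n ≃ₗ[R] Set.range (i n) := fun n => ((e n).symm.linearEquiv R).symm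
  let N : BddMod R κ :=
    { carrier := fun n => Set.range (i n)
      map := fun {m n} f => (l n).toLinearMap ∘ₗ (M.map f).hom ∘ₗ (l m).symm.toLinearMap
      map_id := by
        intro n
        ext x
        simp
      map_comp := by
        intro a b c f g
        ext x
        simp
      card_le := by
        refine le_trans (le_of_eq ?_) hM
        exact Cardinal.mk_congr (Equiv.sigmaCongrRight fun n => (e n).symm) }
  refine ⟨N, ⟨NatIso.ofComponents (fun n => (l n).toModuleIso) ?_⟩⟩
  intro m n f
  ext x
  change l n (M.map f x) = l n (M.map f ((l m).symm (l m x)))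
  rw [LinearEquiv.symm_apply_apply]

end Bounded

/-! ### The bounded monad -/

section Monad

/-- The functor `Hom(Y, -)` with values in pointed sets, the base point being the zero map. -/
@[simps]
def homFunctor (Y : PSSet.{u}) : PSSet.{u} ⥤ Pointed.{u} where
  obj Z := ⟨Y ⟶ Z, zeroMap Y Z⟩
  map f := ⟨fun g => g ≫ f, by
    apply NatTrans.ext
    funext n
    apply Pointed.Hom.ext
    funext y
    exact (f.app n).map_point⟩

/-- The functor `Hom(-, -)` with values in pointed sets. -/
def homBifunctor : PSSet.{u}ᵒᵖ ⥤ PSSet.{u} ⥤ Pointed.{u} where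
  obj Y := homFunctor Y.unop
  map f :=
    { app := fun Z => ⟨fun g => f.unop ≫ g, rfl⟩ }

variable (R : Type u) [CommRing R] (κ : Cardinal.{u})

/-- The path fibrations `p_M : P M ⟶ M` of the bounded simplicial modules `M`. -/
def pathDiagram : BddMod R κ ⥤ Arrow PSSet.{u} where
  obj M := Arrow.mk (pathEnd ((toPSSet R).obj M.toSMod))
  map j := Arrow.homMk (pathMap ((toPSSet R).map j.1)) ((toPSSet R).map j.1)
    (pathMap_pathEnd _)

/-- The category of discrete `R`-mapping algebras: functors from the category of bounded simplicial
modules to arrows of pointed sets. -/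
abbrev DiscMapAlg : Type (u + 1) := BddMod R κ ⥤ Arrow Pointed.{u}

/-- The functor taking a space `Y` to its discrete mapping algebra
`M ↦ (p_M : Hom(Y, P M) ⟶ Hom(Y, M))`, with values in the opposite category. -/
def leftFunctor : PSSet.{u} ⥤ (DiscMapAlg R κ)ᵒᵖ :=
  (homBifunctor ⋙ Functor.mapArrowFunctor _ _ ⋙
    (Functor.whiskeringLeft _ _ _).obj (pathDiagram R κ)).rightOp

/-- The discrete mapping algebra `M ↦ (p_M : (P M)_n ⟶ M_n)` of `n`-simplices, as a functor
of `n`. -/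
def simplexAlg : SimplexCategoryᵒᵖ ⥤ DiscMapAlg R κ :=
  evaluation _ _ ⋙ Functor.mapArrowFunctor _ _ ⋙
    (Functor.whiskeringLeft _ _ _).obj (pathDiagram R κ)

variable {R κ}

/-- The zero map from a discrete mapping algebra to that of `n`-simplices. -/
def zeroAlgMap (A : DiscMapAlg R κ) (n : SimplexCategoryᵒᵖ) : A ⟶ (simplexAlg R κ).obj n where
  app M := Arrow.homMk ⟨fun _ => ((pathObj ((toPSSet R).obj M.toSMod)).obj n).point, rfl⟩
    ⟨fun _ => (((toPSSet R).obj M.toSMod).obj n).point, rfl⟩ (by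
      apply Pointed.Hom.ext
      funext a
      exact ((pathEnd ((toPSSet R).obj M.toSMod)).app n).map_point)
  naturality M N j := by
    apply Arrow.hom_ext
    · apply Pointed.Hom.ext
      funext a
      exact (((pathMap ((toPSSet R).map j.1)).app n).map_point).symm
    · apply Pointed.Hom.ext
      funext a
      exact ((((toPSSet R).map j.1).app n).map_point).symm

variable (R κ)

/-- The right adjoint of `leftFunctor`: the `n`-simplices of its value at `A` are the maps from
`A` to the discrete mapping algebra of `n`-simplices. -/
def rightFunctor : (DiscMapAlg R κ)ᵒᵖ ⥤ PSSet.{u} where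
  obj A :=
    { obj := fun n => ⟨A.unop ⟶ (simplexAlg R κ).obj n, zeroAlgMap A.unop n⟩
      map := fun {m n} g => ⟨fun τ => τ ≫ (simplexAlg R κ).map g, by
        apply NatTrans.ext
        funext M
        apply Arrow.hom_ext
        · apply Pointed.Hom.ext
          funext a
          exact map_point (pathObj ((toPSSet R).obj M.toSMod)) g
        · apply Pointed.Hom.ext
          funext a
          exact map_point ((toPSSet R).obj M.toSMod) g⟩
      map_id := fun n => by
        apply Pointed.Hom.ext
        funext τ
        change τ ≫ (simplexAlg R κ).map (𝟙 n) = τ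
        rw [CategoryTheory.Functor.map_id, Category.comp_id]
      map_comp := fun f g => by
        apply Pointed.Hom.ext
        funext τ
        change τ ≫ (simplexAlg R κ).map (f ≫ g)
          = (τ ≫ (simplexAlg R κ).map f) ≫ (simplexAlg R κ).map g
        rw [CategoryTheory.Functor.map_comp, Category.assoc] }
  map f :=
    { app := fun n => ⟨fun τ => f.unop ≫ τ, rfl⟩
      naturality := fun m n g => by
        apply Pointed.Hom.ext
        funext τ
        exact (Category.assoc _ _ _).symm }

/-- The bijection of the adjunction between `leftFunctor` and `rightFunctor`. -/
def adjHomEquiv (Y : PSSet.{u}) (A : DiscMapAlg R κ) :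
    (A ⟶ ((leftFunctor R κ).obj Y).unop) ≃ (Y ⟶ (rightFunctor R κ).obj (op A)) where
  toFun τ :=
    { app := fun n => ⟨fun y =>
        { app := fun M => Arrow.homMk
            ⟨fun a => (((τ.app M).left.toFun a : Y ⟶ pathObj ((toPSSet R).obj M.toSMod)).app
              n).toFun y, by rw [(τ.app M).left.map_point]; rfl⟩
            ⟨fun a => (((τ.app M).right.toFun a : Y ⟶ (toPSSet R).obj M.toSMod).app
              n).toFun y, by rw [(τ.app M).right.map_point]; rfl⟩ (by
            apply Pointed.Hom.ext
            funext a
            have h := congrFun (congrArg Pointed.Hom.toFun (τ.app M).w) a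
            exact (congrArg (fun k : Y ⟶ (toPSSet R).obj M.toSMod => (k.app n).toFun y) h))
          naturality := fun M N j => by
            apply Arrow.hom_ext
            · apply Pointed.Hom.ext
              funext a
              have h := congrFun (congrArg (fun k => Pointed.Hom.toFun (CommaMorphism.left k))
                (τ.naturality j)) a
              exact (congrArg (fun k : Y ⟶ pathObj ((toPSSet R).obj N.toSMod) =>
                (k.app n).toFun y) h)
            · apply Pointed.Hom.ext
              funext a
              have h := congrFun (congrArg (fun k => Pointed.Hom.toFun (CommaMorphism.right k))
                (τ.naturality j)) a
              exact (congrArg (fun k : Y ⟶ (toPSSet R).obj N.toSMod =>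
                (k.app n).toFun y) h) }, by
        apply NatTrans.ext
        funext M
        apply Arrow.hom_ext
        · apply Pointed.Hom.ext
          funext a
          exact (((τ.app M).left.toFun a : Y ⟶ pathObj ((toPSSet R).obj M.toSMod)).app
            n).map_point
        · apply Pointed.Hom.ext
          funext a
          exact (((τ.app M).right.toFun a : Y ⟶ (toPSSet R).obj M.toSMod).app n).map_point⟩
      naturality := fun m n g => by
        apply Pointed.Hom.ext
        funext y
        apply NatTrans.ext
        funext M
        apply Arrow.hom_ext
        · apply Pointed.Hom.ext
          funext a
          exact congrFun (congrArg Pointed.Hom.toFun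
            (((τ.app M).left.toFun a : Y ⟶ pathObj ((toPSSet R).obj M.toSMod)).naturality g)) y
        · apply Pointed.Hom.ext
          funext a
          exact congrFun (congrArg Pointed.Hom.toFun
            (((τ.app M).right.toFun a : Y ⟶ (toPSSet R).obj M.toSMod).naturality g)) y }
  invFun σ :=
    { app := fun M => Arrow.homMk
        ⟨fun a => (
          { app := fun n => ⟨fun y => ((((σ.app n).toFun y :
              A ⟶ (simplexAlg R κ).obj n).app M).left.toFun a), by
                rw [(σ.app n).map_point]; rfl⟩
            naturality := fun m n g => by
              apply Pointed.Hom.ext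
              funext y
              have h := congrFun (congrArg Pointed.Hom.toFun (σ.naturality g)) y
              exact congrArg (fun k : A ⟶ (simplexAlg R κ).obj n =>
                (k.app M).left.toFun a) h } : Y ⟶ pathObj ((toPSSet R).obj M.toSMod)), by
          apply NatTrans.ext
          funext n
          apply Pointed.Hom.ext
          funext y
          exact (((σ.app n).toFun y : A ⟶ (simplexAlg R κ).obj n).app M).left.map_point⟩
        ⟨fun a => (
          { app := fun n => ⟨fun y => ((((σ.app n).toFun y :
              A ⟶ (simplexAlg R κ).obj n).app M).right.toFun a), by
                rw [(σ.app n).map_point]; rfl⟩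
            naturality := fun m n g => by
              apply Pointed.Hom.ext
              funext y
              have h := congrFun (congrArg Pointed.Hom.toFun (σ.naturality g)) y
              exact congrArg (fun k : A ⟶ (simplexAlg R κ).obj n =>
                (k.app M).right.toFun a) h } : Y ⟶ (toPSSet R).obj M.toSMod), by
          apply NatTrans.ext
          funext n
          apply Pointed.Hom.ext
          funext y
          exact (((σ.app n).toFun y : A ⟶ (simplexAlg R κ).obj n).app M).right.map_point⟩ (by
          apply Pointed.Hom.ext
          funext a
          apply NatTrans.ext
          funext n
          apply Pointed.Hom.ext
          funext y
          exact congrFun (congrArg Pointed.Hom.toFun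
            (((σ.app n).toFun y : A ⟶ (simplexAlg R κ).obj n).app M).w) a)
      naturality := fun M N j => by
        apply Arrow.hom_ext
        · apply Pointed.Hom.ext
          funext a
          apply NatTrans.ext
          funext n
          apply Pointed.Hom.ext
          funext y
          exact congrFun (congrArg (fun k => Pointed.Hom.toFun (CommaMorphism.left k))
            (((σ.app n).toFun y : A ⟶ (simplexAlg R κ).obj n).naturality j)) a
        · apply Pointed.Hom.ext
          funext a
          apply NatTrans.ext
          funext n
          apply Pointed.Hom.ext
          funext y
          exact congrFun (congrArg (fun k => Pointed.Hom.toFun (CommaMorphism.right k))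
            (((σ.app n).toFun y : A ⟶ (simplexAlg R κ).obj n).naturality j)) a }
  left_inv τ := by
    apply NatTrans.ext
    funext M
    apply Arrow.hom_ext <;> rfl
  right_inv σ := by
    apply NatTrans.ext
    funext n
    apply Pointed.Hom.ext
    funext y
    apply NatTrans.ext
    funext M
    apply Arrow.hom_ext <;> rfl

/-- The adjunction between spaces and the opposite of discrete mapping algebras. -/
def adj : leftFunctor R κ ⊣ rightFunctor R κ :=
  Adjunction.mkOfHomEquiv
    { homEquiv := fun Y A => (opEquiv _ _).trans (adjHomEquiv R κ Y A.unop)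
      homEquiv_naturality_left_symm := fun _ _ => rfl
      homEquiv_naturality_right := fun _ _ => rfl }

/-- The monad on pointed simplicial sets induced by the adjunction. -/
def boundedMonad : Monad PSSet.{u} := (adj R κ).toMonad

variable {R κ}

/-- The projection of the bounded monad at `X` to the copy of `N` indexed by `φ : X ⟶ N`. -/
def monadProj {X : PSSet.{u}} (N : BddMod R κ) (φ : X ⟶ (toPSSet R).obj N.toSMod) :
    (boundedMonad R κ).obj X ⟶ (toPSSet R).obj N.toSMod where
  app n := ⟨fun τ => (NatTrans.app (F := ((leftFunctor R κ).obj X).unop)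
    (G := (simplexAlg R κ).obj n) τ N).right.toFun φ, rfl⟩
  naturality _ _ _ := rfl

/-- The projection of the bounded monad at `X` to the copy of `P N` indexed by `Φ : X ⟶ P N`. -/
def monadPathProj {X : PSSet.{u}} (N : BddMod R κ)
    (Φ : X ⟶ pathObj ((toPSSet R).obj N.toSMod)) :
    (boundedMonad R κ).obj X ⟶ pathObj ((toPSSet R).obj N.toSMod) where
  app n := ⟨fun τ => (NatTrans.app (F := ((leftFunctor R κ).obj X).unop)
    (G := (simplexAlg R κ).obj n) τ N).left.toFun Φ, rfl⟩
  naturality _ _ _ := rfl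

end Monad

/-! ### Products and pullbacks of pointed simplicial sets -/

section Limits

/-- The product of a family of pointed simplicial sets. -/
def piObj {ι : Type u} (Y : ι → PSSet.{u}) : PSSet.{u} where
  obj n := ⟨∀ i, ((Y i).obj n).X, fun i => ((Y i).obj n).point⟩
  map g := ⟨fun y i => ((Y i).map g).toFun (y i), funext fun i => map_point (Y i) g⟩
  map_id n := by
    apply Pointed.Hom.ext
    funext y i
    exact congrFun (congrArg Pointed.Hom.toFun ((Y i).map_id n)) (y i)
  map_comp f g := by
    apply Pointed.Hom.ext
    funext y i
    exact congrFun (congrArg Pointed.Hom.toFun ((Y i).map_comp f g)) (y i)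

/-- The projections of the product. -/
def piProj {ι : Type u} (Y : ι → PSSet.{u}) (i : ι) : piObj Y ⟶ Y i where
  app n := ⟨fun y => y i, rfl⟩

/-- The map to a product with given components. -/
def piLift {ι : Type u} {Y : ι → PSSet.{u}} {Z : PSSet.{u}} (f : ∀ i, Z ⟶ Y i) :
    Z ⟶ piObj Y where
  app n := ⟨fun z i => ((f i).app n).toFun z, funext fun i => ((f i).app n).map_point⟩
  naturality m n g := by
    apply Pointed.Hom.ext
    funext z i
    exact congrFun (congrArg Pointed.Hom.toFun ((f i).naturality g)) z

/-- The product of a family of maps. -/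
def piMap {ι : Type u} {Y Z : ι → PSSet.{u}} (f : ∀ i, Y i ⟶ Z i) : piObj Y ⟶ piObj Z :=
  piLift fun i => piProj Y i ≫ f i

/-- The pullback of two maps of pointed simplicial sets. -/
def pullbackObj {A B C : PSSet.{u}} (f : A ⟶ C) (g : B ⟶ C) : PSSet.{u} where
  obj n := ⟨{x : (A.obj n).X × (B.obj n).X // (f.app n).toFun x.1 = (g.app n).toFun x.2},
    ⟨((A.obj n).point, (B.obj n).point), (f.app n).map_point.trans (g.app n).map_point.symm⟩⟩
  map {m n} h := ⟨fun x => ⟨((A.map h).toFun x.1.1, (B.map h).toFun x.1.2), by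
      have h1 := congrFun (congrArg Pointed.Hom.toFun (f.naturality h)) x.1.1
      have h2 := congrFun (congrArg Pointed.Hom.toFun (g.naturality h)) x.1.2
      exact h1.trans ((congrArg (C.map h).toFun x.2).trans h2.symm)⟩,
    Subtype.ext (Prod.ext (map_point A h) (map_point B h))⟩
  map_id n := by
    apply Pointed.Hom.ext
    funext x
    exact Subtype.ext (Prod.ext (congrFun (congrArg Pointed.Hom.toFun (A.map_id n)) x.1.1)
      (congrFun (congrArg Pointed.Hom.toFun (B.map_id n)) x.1.2))
  map_comp h k := by
    apply Pointed.Hom.ext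
    funext x
    exact Subtype.ext (Prod.ext (congrFun (congrArg Pointed.Hom.toFun (A.map_comp h k)) x.1.1)
      (congrFun (congrArg Pointed.Hom.toFun (B.map_comp h k)) x.1.2))

/-- The first projection of the pullback. -/
def pullbackFst {A B C : PSSet.{u}} (f : A ⟶ C) (g : B ⟶ C) : pullbackObj f g ⟶ A where
  app n := ⟨fun x => x.1.1, rfl⟩

/-- The second projection of the pullback. -/
def pullbackSnd {A B C : PSSet.{u}} (f : A ⟶ C) (g : B ⟶ C) : pullbackObj f g ⟶ B where
  app n := ⟨fun x => x.1.2, rfl⟩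

end Limits

/-! ### The modified dual Stover construction -/

section Modified

variable {R : Type u} [CommRing R]

lemma coneAdj_comp {X Y Z : PSSet.{u}} (Φ : X ⟶ pathObj Y) (g : Y ⟶ Z) :
    coneAdj (Φ ≫ pathMap g) = coneAdj Φ ≫ g := by
  apply NatTrans.ext
  funext n
  apply Pointed.Hom.ext
  funext q
  induction q using Quotient.inductionOn with
  | h a => rfl

lemma IsEffEpi.comp_iso {X : PSSet.{u}} {M M' : SMod R} {f : X ⟶ (toPSSet R).obj M}
    (hf : IsEffEpi f) (e : M ≅ M') : IsEffEpi (f ≫ (toPSSet R).map e.hom) := by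
  intro n
  have h := hf n
  rw [hIm_obj] at h ⊢
  have h1 : levelImage (f ≫ (toPSSet R).map e.hom) n
      = (e.hom.app n).hom '' levelImage f n := by
    ext x
    constructor
    · rintro ⟨y, rfl⟩
      exact ⟨_, ⟨y, rfl⟩, rfl⟩
    · rintro ⟨_, ⟨y, rfl⟩, rfl⟩
      exact ⟨y, rfl⟩
  rw [h1, ← Submodule.map_span, h, Submodule.map_top, LinearMap.range_eq_top]
  exact (e.app n).toLinearEquiv.surjective

/-- A bound for the cardinality of the targets of the effective epimorphisms from `X`. -/
def freeCard (R : Type u) [CommRing R] (X : PSSet.{u}) : Cardinal.{u} :=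
  Cardinal.mk (Σ n, ((X.obj n).X →₀ R))

lemma mk_hIm_le {X : PSSet.{u}} {M : SMod R} (f : X ⟶ (toPSSet R).obj M) :
    Cardinal.mk (Simplices ((toPSSet R).obj (hIm f).toSMod)) ≤ freeCard R X := by
  let s : ∀ n, ((X.obj n).X →₀ R) →ₗ[R] M.obj n := fun n =>
    Finsupp.linearCombination R ((f.app n).toFun : (X.obj n).X → M.obj n)
  have hr : ∀ n, (hIm f).obj n = LinearMap.range (s n) := fun n => by
    rw [hIm_obj]
    exact (Finsupp.range_linearCombination (M := M.obj n) R).symm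
  refine Cardinal.mk_le_of_surjective
    (f := fun a => ⟨a.1, ⟨s a.1 a.2, by rw [hr]; exact ⟨a.2, rfl⟩⟩⟩) ?_
  rintro ⟨n, x, hx⟩
  rw [hr] at hx
  obtain ⟨c, rfl⟩ := hx
  exact ⟨⟨n, c⟩, rfl⟩

lemma IsEffEpi.mk_le {X : PSSet.{u}} {M : SMod R} {f : X ⟶ (toPSSet R).obj M}
    (hf : IsEffEpi f) : Cardinal.mk (Simplices ((toPSSet R).obj M)) ≤ freeCard R X := by
  refine le_trans ?_ (mk_hIm_le f)
  refine Cardinal.mk_le_of_injective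
    (f := fun a => ⟨a.1, ⟨a.2, by rw [hf a.1]; trivial⟩⟩) ?_
  rintro ⟨n, x⟩ ⟨m, y⟩ h
  obtain ⟨rfl, h⟩ := Sigma.mk.inj h
  cases h
  rfl

variable (R)

/-- An effective epimorphism from `X` to a simplicial `R`-module. -/
structure EffEpi (X : PSSet.{u}) : Type (u + 1) where
  /-- the target -/
  M : SMod R
  /-- the map -/
  φ : X ⟶ (toPSSet R).obj M
  eff : IsEffEpi φ

variable {R}

/-- Isomorphism of effective epimorphisms from `X`. -/
instance EffEpi.setoid (X : PSSet.{u}) : Setoid (EffEpi R X) where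
  r E E' := ∃ e : E.M ≅ E'.M, E.φ ≫ (toPSSet R).map e.hom = E'.φ
  iseqv :=
    { refl := fun E => ⟨Iso.refl _, by simp⟩
      symm := by
        rintro E E' ⟨e, he⟩
        refine ⟨e.symm, ?_⟩
        rw [← he, Category.assoc, ← CategoryTheory.Functor.map_comp]
        simp
      trans := by
        rintro E E' E'' ⟨e, he⟩ ⟨e', he'⟩
        refine ⟨e ≪≫ e', ?_⟩
        rw [← he', ← he]
        simp }

/-- There is only a set of isomorphism classes of effective epimorphisms from `X`. -/
instance EffEpi.small (X : PSSet.{u}) : Small.{u} (Quotient (EffEpi.setoid (R := R) X)) := by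
  refine small_of_surjective
    (α := Σ N : BddMod R (freeCard R X), {φ : X ⟶ (toPSSet R).obj N.toSMod // IsEffEpi φ})
    (f := fun a => Quotient.mk _ ⟨a.1.toSMod, a.2.1, a.2.2⟩) ?_
  intro q
  induction q using Quotient.inductionOn with
  | h E =>
    obtain ⟨N, ⟨e⟩⟩ := BddMod.exists_iso E.M E.eff.mk_le
    exact ⟨⟨N, E.φ ≫ (toPSSet R).map e.hom, E.eff.comp_iso e⟩,
      (Quotient.sound ⟨e, rfl⟩ : Quotient.mk (EffEpi.setoid X) E = _).symm⟩

/-- A monomorphism `j : M ⟶ M'` of simplicial `R`-modules together with an effectively surjective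
nullhomotopy `Φ : X ⟶ P M'` of `j ∘ φ`, for a given effective epimorphism `φ : X ⟶ M`. -/
structure EffNull {X : PSSet.{u}} (E : EffEpi R X) : Type (u + 1) where
  /-- the target of the monomorphism -/
  M' : SMod R
  /-- the monomorphism -/
  j : E.M ⟶ M'
  mono : Mono j
  /-- the nullhomotopy -/
  Φ : X ⟶ pathObj ((toPSSet R).obj M')
  null : Φ ≫ pathEnd _ = E.φ ≫ (toPSSet R).map j
  eff : IsEffSurj Φ

/-- Isomorphism of pairs `(j, Φ)`. -/
instance EffNull.setoid {X : PSSet.{u}} (E : EffEpi R X) : Setoid (EffNull E) where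
  r F F' := ∃ e : F.M' ≅ F'.M', F.j ≫ e.hom = F'.j ∧
    F.Φ ≫ pathMap ((toPSSet R).map e.hom) = F'.Φ
  iseqv :=
    { refl := fun F => ⟨Iso.refl _, by simp, by
        rw [Iso.refl_hom, CategoryTheory.Functor.map_id, pathMap_id, Category.comp_id]⟩
      symm := by
        rintro F F' ⟨e, he, he'⟩
        refine ⟨e.symm, by rw [← he]; simp, ?_⟩
        rw [← he', Category.assoc, ← pathMap_comp, ← CategoryTheory.Functor.map_comp,
          Iso.symm_hom, Iso.hom_inv_id, CategoryTheory.Functor.map_id, pathMap_id,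
          Category.comp_id]
      trans := by
        rintro F F' F'' ⟨e, he1, he2⟩ ⟨e', he1', he2'⟩
        refine ⟨e ≪≫ e', by rw [← he1', ← he1]; simp, ?_⟩
        rw [← he2', ← he2, Category.assoc, ← pathMap_comp, ← CategoryTheory.Functor.map_comp,
          Iso.trans_hom] }

/-- There is only a set of isomorphism classes of pairs `(j, Φ)`. -/
instance EffNull.small {X : PSSet.{u}} (E : EffEpi R X) :
    Small.{u} (Quotient (EffNull.setoid E)) := by
  refine small_of_surjective
    (α := Σ N : BddMod R (freeCard R (coneObj X)),
      {a : (E.M ⟶ N.toSMod) × (X ⟶ pathObj ((toPSSet R).obj N.toSMod)) //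
        Mono a.1 ∧ a.2 ≫ pathEnd _ = E.φ ≫ (toPSSet R).map a.1 ∧ IsEffSurj a.2})
    (f := fun a => Quotient.mk _
      ⟨a.1.toSMod, a.2.1.1, a.2.2.1, a.2.1.2, a.2.2.2.1, a.2.2.2.2⟩) ?_
  intro q
  induction q using Quotient.inductionOn with
  | h F =>
    obtain ⟨N, ⟨e⟩⟩ := BddMod.exists_iso F.M' (IsEffEpi.mk_le F.eff)
    have := F.mono
    refine ⟨⟨N, (F.j ≫ e.hom, F.Φ ≫ pathMap ((toPSSet R).map e.hom)), mono_comp _ _, ?_, ?_⟩,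
      (Quotient.sound ⟨e, rfl, rfl⟩ : Quotient.mk (EffNull.setoid E) F = _).symm⟩
    · rw [Category.assoc, pathMap_pathEnd, ← Category.assoc, F.null, Category.assoc,
        ← CategoryTheory.Functor.map_comp]
    · rw [IsEffSurj, coneAdj_comp]
      exact IsEffEpi.comp_iso F.eff e

variable (R)

/-- The index set of the isomorphism classes of effective epimorphisms from `X`. -/
abbrev EffEpiClass (X : PSSet.{u}) : Type u :=
  Shrink.{u} (Quotient (EffEpi.setoid (R := R) X))

variable {R}

/-- A representative of an isomorphism class of effective epimorphisms. -/
def EffEpiClass.rep {X : PSSet.{u}} (i : EffEpiClass R X) : EffEpi R X :=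
  ((equivShrink _).symm i).out

/-- The index set of the isomorphism classes of pairs `(j, Φ)`. -/
abbrev EffNullClass {X : PSSet.{u}} (E : EffEpi R X) : Type u :=
  Shrink.{u} (Quotient (EffNull.setoid E))

/-- A representative of an isomorphism class of pairs `(j, Φ)`. -/
def EffNullClass.rep {X : PSSet.{u}} {E : EffEpi R X} (k : EffNullClass E) : EffNull E :=
  ((equivShrink _).symm k).out

/-- The pullback `Q_φ` of `(j) : M ⟶ ∏ M'` and `∏ p_{M'} : ∏ P M' ⟶ ∏ M'`, the products
being indexed by the pairs `(j : M ⟶ M', Φ)`, up to isomorphism. -/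
def hatQ {X : PSSet.{u}} (E : EffEpi R X) : PSSet.{u} :=
  pullbackObj (piLift fun k : EffNullClass E => (toPSSet R).map k.rep.j)
    (piMap fun k : EffNullClass E => pathEnd ((toPSSet R).obj k.rep.M'))

/-- The projection `Q_φ ⟶ M`. -/
def hatQFst {X : PSSet.{u}} (E : EffEpi R X) : hatQ E ⟶ (toPSSet R).obj E.M := pullbackFst _ _

/-- The projection of `Q_φ` to the copy of `P M'` indexed by `Φ`. -/
def hatQSnd {X : PSSet.{u}} (E : EffEpi R X) (k : EffNullClass E) :
    hatQ E ⟶ pathObj ((toPSSet R).obj k.rep.M') :=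
  pullbackSnd _ _ ≫ piProj (fun k : EffNullClass E => pathObj ((toPSSet R).obj k.rep.M')) k

variable (R)

/-- The modified dual Stover construction: the product of the `Q_φ` over the effective
epimorphisms `φ : X ⟶ M`, up to isomorphism. -/
def hatT (X : PSSet.{u}) : PSSet.{u} := piObj fun i : EffEpiClass R X => hatQ i.rep

variable {R}

/-- The projection of the modified dual Stover construction to `Q_φ`. -/
def hatTProj {X : PSSet.{u}} (i : EffEpiClass R X) : hatT R X ⟶ hatQ i.rep :=
  piProj (fun i : EffEpiClass R X => hatQ i.rep) i

variable (R)

/-- The cardinalities of the simplicial modules generated by the images of the maps `φ : X ⟶ M`,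
and of the path objects `P M''`, where `M''` is generated by the image of the adjoint `C X ⟶ M`
of a map `Φ : X ⟶ P M`. -/
def imageCardinals (X : PSSet.{u}) : Set Cardinal.{u} :=
  {c | ∃ (M : SMod R) (φ : X ⟶ (toPSSet R).obj M),
    c = Cardinal.mk (Simplices ((toPSSet R).obj (hIm φ).toSMod))} ∪
  {c | ∃ (M : SMod R) (Φ : X ⟶ pathObj ((toPSSet R).obj M)),
    c = Cardinal.mk (Simplices (pathObj ((toPSSet R).obj (hIm (coneAdj Φ)).toSMod)))}

lemma bddAbove_imageCardinals (X : PSSet.{u}) : BddAbove (imageCardinals R X) := by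
  refine BddAbove.union ⟨freeCard R X, ?_⟩ ?_
  · rintro _ ⟨M, φ, rfl⟩
    exact mk_hIm_le φ
  · refine BddAbove.mono ?_ (Cardinal.bddAbove_of_small
      (s := Set.range fun N : BddMod R (freeCard R (coneObj X)) =>
        Cardinal.mk (Simplices (pathObj ((toPSSet R).obj N.toSMod)))))
    rintro _ ⟨M, Φ, rfl⟩
    obtain ⟨N, ⟨e⟩⟩ := BddMod.exists_iso _ (mk_hIm_le (coneAdj Φ))
    refine ⟨N, Cardinal.mk_congr (Equiv.sigmaCongrRight fun n => ?_)⟩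
    let e' := (pathFunctor.mapIso ((toPSSet R).mapIso e)).app n
    exact
      { toFun := e'.inv.toFun
        invFun := e'.hom.toFun
        left_inv := congrFun (congrArg Pointed.Hom.toFun e'.inv_hom_id)
        right_inv := congrFun (congrArg Pointed.Hom.toFun e'.hom_inv_id) }

/-- The cardinal `λ_X`. -/
def lambdaCard (X : PSSet.{u}) : Cardinal.{u} := sSup (imageCardinals R X)

end Modified

end

end DualStover

/-! A map `φ : X ⟶ N` to a simplicial module factors uniquely as an effective epimorphism onto
the submodule generated by its image followed by a monomorphism, because effective epimorphisms
lift uniquely against monomorphisms (`IsEffEpi.exists_lift`, `IsEffEpi.hom_ext`). The adjunction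
between `C` and `P` gives the corresponding factorisation of a map `Φ : X ⟶ P N` through `P M'`,
where `M'` is generated by the image of the adjoint `C X ⟶ N`, and `M'` contains the image of the
endpoint `p Φ`. So each `φ` is obtained from exactly one of the chosen effective epimorphisms by a
unique monomorphism, and each `Φ` from exactly one of the chosen pairs (`exists_factor`,
`factor_unique`, `exists_pathFactor`, `pathFactor_unique`).

An `n`-simplex of the bounded monad is a family of simplices of the `N` and `P N`, indexed by the
maps `φ : X ⟶ N` and `Φ : X ⟶ P N`, natural in monomorphisms of `N` and compatible with the path
fibrations. By the factorisations, naturality makes this the same as a family indexed by the chosen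
effective epimorphisms and pairs alone, subject to `p y = j x` for each pair `(j, Φ)`, as soon as
their targets have at most `κ` simplices; and this is a simplex of the modified dual Stover
construction. Families indexed by zero maps are zero since then the generated submodule vanishes.

The bound `λ_X` controls `P M'` rather than `M'`. That `M'` is bounded as well follows from the
surjectivity of `P M' ⟶ M'` for effectively surjective nullhomotopies
(`IsEffSurj.pathEnd_surjective`): the endpoints of the paths form a submodule, and it contains the
image of `C X` because `C X` is contracted to its base point by `(x, t) ↦ (x, min t s)`. -/

namespace DualStover

noncomputable section

/-! ### Effective epimorphisms and monomorphisms -/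

section EffectiveEpimorphisms

variable {R : Type u} [CommRing R]

lemma PSSet.hom_ext {X Y : PSSet.{u}} {f g : X ⟶ Y}
    (h : ∀ n x, (f.app n).toFun x = (g.app n).toFun x) : f = g := by
  apply NatTrans.ext
  funext n
  apply Pointed.Hom.ext
  funext x
  exact h n x

lemma PSSet.congr_app {X Y : PSSet.{u}} {f g : X ⟶ Y} (h : f = g) (n : SimplexCategoryᵒᵖ)
    (x : (X.obj n).X) : (f.app n).toFun x = (g.app n).toFun x := by
  rw [h]

lemma app_injective {M N : SMod R} (j : M ⟶ N) [Mono j] (n : SimplexCategoryᵒᵖ) :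
    Function.Injective (j.app n).hom :=
  (ModuleCat.mono_iff_injective _).1 ((NatTrans.mono_iff_mono_app j).1 inferInstance n)

lemma mono_of_app_injective {M N : SMod R} (j : M ⟶ N)
    (h : ∀ n, Function.Injective (j.app n).hom) : Mono j :=
  (NatTrans.mono_iff_mono_app j).2 fun n => (ModuleCat.mono_iff_injective _).2 (h n)

instance mono_toPSSet_map {M N : SMod R} (j : M ⟶ N) [Mono j] : Mono ((toPSSet R).map j) where
  right_cancellation _ _ h := PSSet.hom_ext fun n x => app_injective j n (PSSet.congr_app h n x)

lemma IsEffEpi.span_eq_top {X : PSSet.{u}} {M : SMod R} {f : X ⟶ (toPSSet R).obj M}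
    (hf : IsEffEpi f) (n : SimplexCategoryᵒᵖ) : Submodule.span R (levelImage f n) = ⊤ := by
  rw [← hIm_obj, hf n]

lemma IsEffEpi.hom_ext {X : PSSet.{u}} {M N : SMod R} {f : X ⟶ (toPSSet R).obj M}
    (hf : IsEffEpi f) {a b : M ⟶ N} (h : f ≫ (toPSSet R).map a = f ≫ (toPSSet R).map b) :
    a = b := by
  apply NatTrans.ext
  funext n
  apply ModuleCat.hom_ext
  refine LinearMap.ext_on (hf.span_eq_top n) ?_
  rintro _ ⟨x, rfl⟩
  exact PSSet.congr_app h n x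

/-- Effective epimorphisms have the left lifting property against monomorphisms. -/
lemma IsEffEpi.exists_lift {X : PSSet.{u}} {M M' N : SMod R} {f : X ⟶ (toPSSet R).obj M}
    (hf : IsEffEpi f) {g : X ⟶ (toPSSet R).obj M'} (j : M ⟶ N) (j' : M' ⟶ N) [Mono j']
    (h : f ≫ (toPSSet R).map j = g ≫ (toPSSet R).map j') :
    ∃ e : M ⟶ M', f ≫ (toPSSet R).map e = g ∧ e ≫ j' = j := by
  have hr : ∀ n x, (j.app n).hom x ∈ LinearMap.range (j'.app n).hom := by
    intro n x
    have hx : x ∈ Submodule.span R (levelImage f n) := by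
      rw [hf.span_eq_top n]
      trivial
    have hle : Submodule.span R (levelImage f n)
        ≤ (LinearMap.range (j'.app n).hom).comap (j.app n).hom := by
      rw [Submodule.span_le]
      rintro _ ⟨y, rfl⟩
      exact ⟨(g.app n).toFun y, PSSet.congr_app h.symm n y⟩
    exact hle hx
  let l : ∀ n, M.obj n →ₗ[R] M'.obj n := fun n =>
    (LinearEquiv.ofInjective (j'.app n).hom (app_injective j' n)).symm.toLinearMap ∘ₗ
      LinearMap.codRestrict _ (j.app n).hom (hr n)
  have hl : ∀ n x, (j'.app n).hom (l n x) = (j.app n).hom x := fun n x =>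
    congrArg Subtype.val ((LinearEquiv.ofInjective (j'.app n).hom
      (app_injective j' n)).apply_symm_apply ⟨(j.app n).hom x, hr n x⟩)
  let e : M ⟶ M' :=
    { app := fun n => ModuleCat.ofHom (l n)
      naturality := fun m n a => by
        ext x
        apply app_injective j' n
        have h1 := ConcreteCategory.congr_hom (j.naturality a) x
        have h2 := ConcreteCategory.congr_hom (j'.naturality a) (l m x)
        change (j'.app n).hom (l n ((M.map a).hom x))
          = (j'.app n).hom ((M'.map a).hom (l m x))
        rw [hl]
        refine h1.trans (Eq.trans ?_ h2.symm)
        exact congrArg (N.map a).hom (hl m x).symm }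
  have he : e ≫ j' = j := by
    ext n x
    exact hl n x
  refine ⟨e, ?_, he⟩
  rw [← cancel_mono ((toPSSet R).map j'), Category.assoc, ← Functor.map_comp, he, h]

lemma IsEffEpi.exists_iso {X : PSSet.{u}} {M M' N : SMod R} {f : X ⟶ (toPSSet R).obj M}
    {g : X ⟶ (toPSSet R).obj M'} (hf : IsEffEpi f) (hg : IsEffEpi g) (j : M ⟶ N) (j' : M' ⟶ N)
    [Mono j] [Mono j'] (h : f ≫ (toPSSet R).map j = g ≫ (toPSSet R).map j') :
    ∃ e : M ≅ M', f ≫ (toPSSet R).map e.hom = g ∧ e.hom ≫ j' = j := by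
  obtain ⟨a, ha, ha'⟩ := hf.exists_lift j j' h
  obtain ⟨b, hb, hb'⟩ := hg.exists_lift j' j h.symm
  refine ⟨⟨a, b, ?_, ?_⟩, ha, ha'⟩
  · rw [← cancel_mono j, Category.assoc, hb', ha', Category.id_comp]
  · rw [← cancel_mono j', Category.assoc, ha', hb', Category.id_comp]

/-- The inclusion of a simplicial submodule. -/
def SimplicialSubmodule.ι {M : SMod R} (N : SimplicialSubmodule M) : N.toSMod ⟶ M where
  app n := ModuleCat.ofHom (N.obj n).subtype

instance SimplicialSubmodule.mono_ι {M : SMod R} (N : SimplicialSubmodule M) : Mono N.ι :=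
  mono_of_app_injective _ fun n => (N.obj n).subtype_injective

lemma apply_mem_hIm {X : PSSet.{u}} {M : SMod R} (f : X ⟶ (toPSSet R).obj M)
    (n : SimplexCategoryᵒᵖ) (x : (X.obj n).X) : (f.app n).toFun x ∈ (hIm f).obj n := by
  rw [hIm_obj]
  exact Submodule.subset_span ⟨x, rfl⟩

/-- The corestriction of a map to the simplicial submodule generated by its image. -/
def toIm {X : PSSet.{u}} {M : SMod R} (f : X ⟶ (toPSSet R).obj M) :
    X ⟶ (toPSSet R).obj (hIm f).toSMod where
  app n := ⟨fun x => ⟨(f.app n).toFun x, apply_mem_hIm f n x⟩, Subtype.ext (f.app n).map_point⟩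
  naturality m n g := by
    apply Pointed.Hom.ext
    funext x
    exact Subtype.ext (congrFun (congrArg Pointed.Hom.toFun (f.naturality g)) x)

lemma toIm_ι {X : PSSet.{u}} {M : SMod R} (f : X ⟶ (toPSSet R).obj M) :
    toIm f ≫ (toPSSet R).map (hIm f).ι = f := rfl

lemma isEffEpi_toIm {X : PSSet.{u}} {M : SMod R} (f : X ⟶ (toPSSet R).obj M) :
    IsEffEpi (toIm f) := by
  intro n
  rw [hIm_obj]
  apply Submodule.map_injective_of_injective ((hIm f).obj n).subtype_injective
  have h : ((hIm f).obj n).subtype '' levelImage (toIm f) n = levelImage f n := by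
    ext x
    constructor
    · rintro ⟨_, ⟨y, rfl⟩, rfl⟩
      exact ⟨y, rfl⟩
    · rintro ⟨y, rfl⟩
      exact ⟨_, ⟨y, rfl⟩, rfl⟩
  refine (Submodule.map_span ((hIm f).obj n).subtype (levelImage (toIm f) n)).trans ?_
  refine (congrArg (Submodule.span R) h).trans ?_
  rw [← hIm_obj]
  exact (Submodule.map_subtype_top _).symm

lemma IsEffEpi.eq_zero {X : PSSet.{u}} {M N : SMod R} {f : X ⟶ (toPSSet R).obj M}
    (hf : IsEffEpi f) {j : M ⟶ N} (h : f ≫ (toPSSet R).map j = zeroMap _ _) : j = 0 := by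
  refine hf.hom_ext (h.trans ?_)
  exact PSSet.hom_ext fun n x => rfl

end EffectiveEpimorphisms

/-! ### The adjunction between cones and path objects -/

section Cones

/-- By naturality, the nullhomotopy `Φ` is recovered from its adjoint: `Φ x (f, t)` is the value of
the adjoint at `(f^* x, t)`. -/
lemma app_eq_coneAdj {X Y : PSSet.{u}} (Φ : X ⟶ pathObj Y) {n m : SimplexCategoryᵒᵖ}
    (x : (X.obj n).X) (a : (SSet.stdSimplex.obj n.unop ⊗ Δ[1] : SSet.{u}).obj m) :
    ((Φ.app n).toFun x).1.app m a = ((coneAdj Φ).app m).toFun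
      (Quotient.mk (coneSetoid X m) ((X.map (SSet.stdSimplex.objEquiv a.1).op).toFun x, a.2)) := by
  have h := congrFun (congrArg Pointed.Hom.toFun
    (Φ.naturality (SSet.stdSimplex.objEquiv a.1).op)) x
  change _ = ((Φ.app m).toFun ((X.map (SSet.stdSimplex.objEquiv a.1).op).toFun x)).1.app m
    (SSet.stdSimplex.objEquiv.symm (𝟙 m.unop), a.2)
  have h' : (Φ.app m).toFun ((X.map (SSet.stdSimplex.objEquiv a.1).op).toFun x)
    = ((pathObj Y).map (SSet.stdSimplex.objEquiv a.1).op).toFun ((Φ.app n).toFun x) := h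
  rw [h']
  change _ = ((Φ.app n).toFun x).1.app m
    ((SSet.stdSimplex.map (SSet.stdSimplex.objEquiv a.1)).app m
      (SSet.stdSimplex.objEquiv.symm (𝟙 m.unop)), a.2)
  refine congrArg (((Φ.app n).toFun x).1.app m) (Prod.ext ?_ rfl)
  exact SSet.stdSimplex.objEquiv.injective (Category.id_comp _).symm

lemma coneAdj_injective {X Y : PSSet.{u}} :
    Function.Injective (coneAdj : (X ⟶ pathObj Y) → (coneObj X ⟶ Y)) := by
  intro Φ Ψ h
  refine PSSet.hom_ext fun n x => Subtype.ext ?_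
  apply NatTrans.ext
  funext m
  ext a
  exact (app_eq_coneAdj Φ x a).trans ((PSSet.congr_app h m _).trans
    (app_eq_coneAdj Ψ x a).symm)

/-- The map `X ⟶ P Y` adjoint to `g : C X ⟶ Y`; it sends `x` to the map
`(f, t) ↦ g (f^* x, t)`. -/
def coneAdjInv {X Y : PSSet.{u}} (g : coneObj X ⟶ Y) : X ⟶ pathObj Y where
  app n := ⟨fun x =>
    ⟨{ app := fun m => TypeCat.ofHom fun a => (g.app m).toFun (Quotient.mk (coneSetoid X m)
          ((X.map (SSet.stdSimplex.objEquiv a.1).op).toFun x, a.2))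
       naturality := fun m k f => by
        ext a
        refine Eq.trans ?_ (congrFun (congrArg Pointed.Hom.toFun (g.naturality f)) _)
        refine congrArg (fun y => (g.app k).toFun (Quotient.mk (coneSetoid X k)
          (y, Δ[1].map f a.2))) ?_
        exact congrFun (congrArg Pointed.Hom.toFun
          (X.map_comp (SSet.stdSimplex.objEquiv a.1).op f)) x },
      by
        ext m b
        refine Eq.trans ?_ ((g.app m).map_point.trans (map_point Y _).symm)
        exact congrArg (g.app m).toFun (Quotient.sound (Or.inr ⟨Or.inr rfl, Or.inl rfl⟩))⟩,
    Subtype.ext (by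
      ext m a
      refine Eq.trans ?_ ((g.app m).map_point.trans (map_point Y _).symm)
      exact congrArg (g.app m).toFun
        (Quotient.sound (Or.inr ⟨Or.inl (map_point X _), Or.inl rfl⟩)))⟩
  naturality n k f := by
    refine Pointed.Hom.ext (funext fun x => Subtype.ext ?_)
    ext m a
    refine congrArg (fun y => (g.app m).toFun (Quotient.mk (coneSetoid X m) (y, a.2))) ?_
    exact (congrFun (congrArg Pointed.Hom.toFun
      (X.map_comp f (SSet.stdSimplex.objEquiv a.1).op)) x).symm

lemma coneAdj_coneAdjInv {X Y : PSSet.{u}} (g : coneObj X ⟶ Y) :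
    coneAdj (coneAdjInv g) = g := by
  refine PSSet.hom_ext fun n q => ?_
  induction q using Quotient.inductionOn with
  | h a =>
    refine congrArg (fun y => (g.app n).toFun (Quotient.mk (coneSetoid X n) (y, a.2))) ?_
    exact congrFun (congrArg Pointed.Hom.toFun (X.map_id n)) a.1

instance mono_pathMap {Y Z : PSSet.{u}} (f : Y ⟶ Z) [Mono f] : Mono (pathMap f) where
  right_cancellation Φ Ψ h := by
    apply coneAdj_injective
    rw [← cancel_mono f, ← coneAdj_comp, h, coneAdj_comp]

lemma coneAdj_zeroMap (X Y : PSSet.{u}) : coneAdj (zeroMap X (pathObj Y)) = zeroMap _ _ := by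
  refine PSSet.hom_ext fun n q => ?_
  induction q using Quotient.inductionOn with
  | h a => exact map_point Y _

lemma IsEffSurj.pathMap_ext {R : Type u} [CommRing R] {X : PSSet.{u}} {M N : SMod R}
    {Φ : X ⟶ pathObj ((toPSSet R).obj M)} (hΦ : IsEffSurj Φ) {a b : M ⟶ N}
    (h : Φ ≫ pathMap ((toPSSet R).map a) = Φ ≫ pathMap ((toPSSet R).map b)) : a = b := by
  refine IsEffEpi.hom_ext hΦ ?_
  rw [← coneAdj_comp, h, coneAdj_comp]

lemma IsEffSurj.exists_iso {R : Type u} [CommRing R] {X : PSSet.{u}} {M M' N : SMod R}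
    {Φ : X ⟶ pathObj ((toPSSet R).obj M)} {Ψ : X ⟶ pathObj ((toPSSet R).obj M')}
    (hΦ : IsEffSurj Φ) (hΨ : IsEffSurj Ψ) (j : M ⟶ N) (j' : M' ⟶ N) [Mono j] [Mono j']
    (h : Φ ≫ pathMap ((toPSSet R).map j) = Ψ ≫ pathMap ((toPSSet R).map j')) :
    ∃ e : M ≅ M', Φ ≫ pathMap ((toPSSet R).map e.hom) = Ψ ∧ e.hom ≫ j' = j := by
  obtain ⟨e, he, he'⟩ := IsEffEpi.exists_iso hΦ hΨ j j' (by rw [← coneAdj_comp, h, coneAdj_comp])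
  refine ⟨e, coneAdj_injective ?_, he'⟩
  rw [coneAdj_comp, he]

lemma IsEffSurj.eq_zero {R : Type u} [CommRing R] {X : PSSet.{u}} {M N : SMod R}
    {Φ : X ⟶ pathObj ((toPSSet R).obj M)} (hΦ : IsEffSurj Φ) {j : M ⟶ N}
    (h : Φ ≫ pathMap ((toPSSet R).map j) = zeroMap _ _) : j = 0 := by
  refine IsEffEpi.eq_zero hΦ ?_
  rw [← coneAdj_comp, h, coneAdj_zeroMap]

/-- The corestriction of a nullhomotopy `Φ : X ⟶ P M` to the path object of the simplicial
submodule generated by the image of its adjoint `C X ⟶ M`. -/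
def toPathIm {R : Type u} [CommRing R] {X : PSSet.{u}} {M : SMod R}
    (Φ : X ⟶ pathObj ((toPSSet R).obj M)) :
    X ⟶ pathObj ((toPSSet R).obj (hIm (coneAdj Φ)).toSMod) :=
  coneAdjInv (toIm (coneAdj Φ))

lemma toPathIm_ι {R : Type u} [CommRing R] {X : PSSet.{u}} {M : SMod R}
    (Φ : X ⟶ pathObj ((toPSSet R).obj M)) :
    toPathIm Φ ≫ pathMap ((toPSSet R).map (hIm (coneAdj Φ)).ι) = Φ := by
  apply coneAdj_injective
  rw [coneAdj_comp, toPathIm, coneAdj_coneAdjInv, toIm_ι]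

lemma isEffSurj_toPathIm {R : Type u} [CommRing R] {X : PSSet.{u}} {M : SMod R}
    (Φ : X ⟶ pathObj ((toPSSet R).obj M)) : IsEffSurj (toPathIm Φ) := by
  rw [IsEffSurj, toPathIm, coneAdj_coneAdjInv]
  exact isEffEpi_toIm _

end Cones

/-! ### Cardinality of the target of an effectively surjective nullhomotopy -/

section Cardinality

/-- The map `Δ[n] × Δ[1] ⟶ Δ[n] × Δ[1]`, `(f, s) ↦ (f, min (f^* t) s)`, for a simplex `t` of
`Δ[1]` of dimension `n`. -/
def minMap {n : SimplexCategoryᵒᵖ} (t : (Δ[1] : SSet.{u}).obj n) :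
    (SSet.stdSimplex.obj n.unop ⊗ Δ[1] : SSet.{u}) ⟶ SSet.stdSimplex.obj n.unop ⊗ Δ[1] where
  app m := TypeCat.ofHom fun a => (a.1, SSet.stdSimplex.objMk
    ((SSet.stdSimplex.objEquiv (Δ[1].map (SSet.stdSimplex.objEquiv a.1).op t)).toOrderHom ⊓
      (SSet.stdSimplex.objEquiv a.2).toOrderHom))

lemma ι₀_minMap {n : SimplexCategoryᵒᵖ} (t : (Δ[1] : SSet.{u}).obj n) :
    SSet.ι₀ ≫ minMap t = SSet.ι₀ := by
  apply NatTrans.ext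
  funext m
  refine ConcreteCategory.hom_ext _ _ fun b => ?_
  refine Prod.ext rfl (SSet.stdSimplex.objEquiv.injective ?_)
  apply SimplexCategory.Hom.ext
  ext k : 2
  exact inf_eq_right.2 (Fin.zero_le _)

/-- The simplex of `P Y` given by precomposing a simplex `h` with `minMap t`. Its endpoint is
the value of `h` at `t`. -/
def contractPath {Y : PSSet.{u}} {n : SimplexCategoryᵒᵖ} (t : (Δ[1] : SSet.{u}).obj n)
    (h : ((pathObj Y).obj n).X) : ((pathObj Y).obj n).X :=
  ⟨minMap t ≫ h.1, by rw [← Category.assoc, ι₀_minMap]; exact h.2⟩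

lemma pathEnd_contractPath {Y : PSSet.{u}} {n : SimplexCategoryᵒᵖ} (t : (Δ[1] : SSet.{u}).obj n)
    (h : ((pathObj Y).obj n).X) : ((pathEnd Y).app n).toFun (contractPath t h)
      = h.1.app n (SSet.stdSimplex.objEquiv.symm (𝟙 n.unop), t) := by
  refine congrArg (h.1.app n) (Prod.ext rfl (SSet.stdSimplex.objEquiv.injective ?_))
  apply SimplexCategory.Hom.ext
  ext k : 2
  have ht : SSet.stdSimplex.objEquiv (Δ[1].map (𝟙 n) t) = SSet.stdSimplex.objEquiv t :=
    congrArg _ (Functor.map_id_apply (Δ[1] : SSet.{u}) n t)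
  refine Eq.trans ?_ (congrArg (fun a => SimplexCategory.Hom.toOrderHom a k) ht)
  exact inf_eq_left.2 (Fin.le_last _)

variable {R : Type u} [CommRing R]

/-- The endpoints of the `n`-simplices of the path object of a simplicial module form a
submodule. -/
def pathEndRange (M : SMod R) (n : SimplexCategoryᵒᵖ) : Submodule R (M.obj n) where
  carrier := Set.range ((pathEnd ((toPSSet R).obj M)).app n).toFun
  zero_mem' := ⟨((pathObj ((toPSSet R).obj M)).obj n).point,
    ((pathEnd ((toPSSet R).obj M)).app n).map_point⟩
  add_mem' := by
    rintro _ _ ⟨h, rfl⟩ ⟨h', rfl⟩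
    refine ⟨⟨{ app := fun m => TypeCat.ofHom fun a =>
                  (fun x y : M.obj m => x + y) (h.1.app m a) (h'.1.app m a)
               naturality := fun m k f => ?_ }, ?_⟩, rfl⟩
    · ext a
      have e := NatTrans.naturality_apply h.1 f a
      have e' := NatTrans.naturality_apply h'.1 f a
      refine Eq.trans ?_ (map_add (M.map f).hom _ _).symm
      exact congrArg₂ (fun x y : M.obj k => x + y) e e'
    · ext m b
      have e := ConcreteCategory.congr_hom (NatTrans.congr_app h.2 m) b
      have e' := ConcreteCategory.congr_hom (NatTrans.congr_app h'.2 m) b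
      have e0 : (constMap (SSet.stdSimplex.obj n.unop) ((toPSSet R).obj M)).app m b
          = (0 : M.obj m) := map_point ((toPSSet R).obj M) _
      refine (congrArg₂ (fun x y : M.obj m => x + y) (e.trans e0) (e'.trans e0)).trans ?_
      exact (add_zero _).trans e0.symm
  smul_mem' := by
    rintro r _ ⟨h, rfl⟩
    refine ⟨⟨{ app := fun m => TypeCat.ofHom fun a => (fun x : M.obj m => r • x) (h.1.app m a)
               naturality := fun m k f => ?_ }, ?_⟩, rfl⟩
    · ext a
      have e := NatTrans.naturality_apply h.1 f a
      refine Eq.trans ?_ (map_smul (M.map f).hom r _).symm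
      exact congrArg (fun x : M.obj k => r • x) e
    · ext m b
      have e := ConcreteCategory.congr_hom (NatTrans.congr_app h.2 m) b
      have e0 : (constMap (SSet.stdSimplex.obj n.unop) ((toPSSet R).obj M)).app m b
          = (0 : M.obj m) := map_point ((toPSSet R).obj M) _
      refine (congrArg (fun x : M.obj m => r • x) (e.trans e0)).trans ?_
      exact (smul_zero _).trans e0.symm

/-- If the image of the connected space `C X` generates `M`, then every simplex of `M` is the
endpoint of a path from the base point. -/
lemma IsEffSurj.pathEnd_surjective {X : PSSet.{u}} {M : SMod R}
    {Φ : X ⟶ pathObj ((toPSSet R).obj M)} (hΦ : IsEffSurj Φ) (n : SimplexCategoryᵒᵖ) :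
    Function.Surjective ((pathEnd ((toPSSet R).obj M)).app n).toFun := by
  have h : Submodule.span R (levelImage (coneAdj Φ) n) ≤ pathEndRange M n := by
    rw [Submodule.span_le]
    rintro _ ⟨q, rfl⟩
    induction q using Quotient.inductionOn with
    | h a => exact ⟨contractPath a.2 ((Φ.app n).toFun a.1), pathEnd_contractPath _ _⟩
  rw [IsEffEpi.span_eq_top hΦ n] at h
  exact fun x => h trivial

lemma IsEffEpi.mk_le_hIm {X : PSSet.{u}} {M : SMod R} {f : X ⟶ (toPSSet R).obj M}
    (hf : IsEffEpi f) : Cardinal.mk (Simplices ((toPSSet R).obj M))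
      ≤ Cardinal.mk (Simplices ((toPSSet R).obj (hIm f).toSMod)) := by
  refine Cardinal.mk_le_of_injective
    (f := fun a => ⟨a.1, ⟨a.2, by rw [hf a.1]; trivial⟩⟩) ?_
  rintro ⟨n, x⟩ ⟨m, y⟩ h
  obtain ⟨rfl, h⟩ := Sigma.mk.inj h
  cases h
  rfl

lemma IsEffEpi.mk_le_of_lambdaCard_le {X : PSSet.{u}} {κ : Cardinal.{u}}
    (hκ : lambdaCard R X ≤ κ) {M : SMod R} {f : X ⟶ (toPSSet R).obj M} (hf : IsEffEpi f) :
    Cardinal.mk (Simplices ((toPSSet R).obj M)) ≤ κ :=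
  (hf.mk_le_hIm.trans (le_csSup (bddAbove_imageCardinals R X) (Or.inl ⟨M, f, rfl⟩))).trans hκ

/-- The cardinal `λ_X` bounds the path object `P M`, which maps onto `M`. -/
lemma IsEffSurj.mk_le_of_lambdaCard_le {X : PSSet.{u}} {κ : Cardinal.{u}}
    (hκ : lambdaCard R X ≤ κ) {M : SMod R} {Φ : X ⟶ pathObj ((toPSSet R).obj M)}
    (hΦ : IsEffSurj Φ) : Cardinal.mk (Simplices ((toPSSet R).obj M)) ≤ κ := by
  refine (IsEffEpi.mk_le_hIm hΦ).trans (le_trans ?_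
    ((le_csSup (bddAbove_imageCardinals R X) (Or.inr ⟨M, Φ, rfl⟩)).trans hκ))
  refine Cardinal.mk_le_of_surjective
    (f := fun a => ⟨a.1, ((pathEnd ((toPSSet R).obj _)).app a.1).toFun a.2⟩) ?_
  rintro ⟨n, x⟩
  obtain ⟨h, rfl⟩ := (isEffSurj_toPathIm Φ).pathEnd_surjective n x
  exact ⟨⟨n, h⟩, rfl⟩

end Cardinality

/-! ### Universal properties of the two constructions -/

section UniversalProperties

variable {R : Type u} [CommRing R] {κ : Cardinal.{u}} {X Z : PSSet.{u}}

lemma monadProj_naturality {N N' : BddMod R κ} (φ : X ⟶ (toPSSet R).obj N.toSMod)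
    (j : N.toSMod ⟶ N'.toSMod) [hj : Mono j] :
    monadProj N' (φ ≫ (toPSSet R).map j) = monadProj N φ ≫ (toPSSet R).map j := by
  refine PSSet.hom_ext fun n τ => ?_
  have h := NatTrans.naturality (F := ((leftFunctor R κ).obj X).unop)
    (G := (simplexAlg R κ).obj n) τ (⟨j, hj⟩ : N ⟶ N')
  exact congrFun (congrArg (fun k => Pointed.Hom.toFun (CommaMorphism.right k)) h) φ

lemma monadPathProj_naturality {N N' : BddMod R κ} (Φ : X ⟶ pathObj ((toPSSet R).obj N.toSMod))
    (j : N.toSMod ⟶ N'.toSMod) [hj : Mono j] :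
    monadPathProj N' (Φ ≫ pathMap ((toPSSet R).map j))
      = monadPathProj N Φ ≫ pathMap ((toPSSet R).map j) := by
  refine PSSet.hom_ext fun n τ => ?_
  have h := NatTrans.naturality (F := ((leftFunctor R κ).obj X).unop)
    (G := (simplexAlg R κ).obj n) τ (⟨j, hj⟩ : N ⟶ N')
  exact congrFun (congrArg (fun k => Pointed.Hom.toFun (CommaMorphism.left k)) h) Φ

lemma monadPathProj_pathEnd {N : BddMod R κ} (Φ : X ⟶ pathObj ((toPSSet R).obj N.toSMod)) :
    monadPathProj N Φ ≫ pathEnd _ = monadProj N (Φ ≫ pathEnd _) := by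
  refine PSSet.hom_ext fun n τ => ?_
  have h := (NatTrans.app (F := ((leftFunctor R κ).obj X).unop)
    (G := (simplexAlg R κ).obj n) τ N).w
  exact (congrFun (congrArg Pointed.Hom.toFun h) Φ)

lemma boundedMonad_hom_ext {f g : Z ⟶ (boundedMonad R κ).obj X}
    (h : ∀ (N : BddMod R κ) (φ : X ⟶ (toPSSet R).obj N.toSMod),
      f ≫ monadProj N φ = g ≫ monadProj N φ)
    (h' : ∀ (N : BddMod R κ) (Φ : X ⟶ pathObj ((toPSSet R).obj N.toSMod)),
      f ≫ monadPathProj N Φ = g ≫ monadPathProj N Φ) : f = g := by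
  refine PSSet.hom_ext fun n z => ?_
  refine NatTrans.ext (F := ((leftFunctor R κ).obj X).unop)
    (G := (simplexAlg R κ).obj n) (funext fun N => ?_)
  apply Arrow.hom_ext
  · exact Pointed.Hom.ext (funext fun Φ => PSSet.congr_app (h' N Φ) n z)
  · exact Pointed.Hom.ext (funext fun φ => PSSet.congr_app (h N φ) n z)

/-- The map to the bounded monad at `X` with given projections. -/
def monadLift
    (a : ∀ N : BddMod R κ, (X ⟶ (toPSSet R).obj N.toSMod) → (Z ⟶ (toPSSet R).obj N.toSMod))
    (b : ∀ N : BddMod R κ, (X ⟶ pathObj ((toPSSet R).obj N.toSMod)) →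
      (Z ⟶ pathObj ((toPSSet R).obj N.toSMod)))
    (ha₀ : ∀ N, a N (zeroMap _ _) = zeroMap _ _) (hb₀ : ∀ N, b N (zeroMap _ _) = zeroMap _ _)
    (hp : ∀ N Φ, b N Φ ≫ pathEnd _ = a N (Φ ≫ pathEnd _))
    (ha : ∀ (N N' : BddMod R κ) (j : N.toSMod ⟶ N'.toSMod) (_ : Mono j) φ,
      a N' (φ ≫ (toPSSet R).map j) = a N φ ≫ (toPSSet R).map j)
    (hb : ∀ (N N' : BddMod R κ) (j : N.toSMod ⟶ N'.toSMod) (_ : Mono j) Φ,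
      b N' (Φ ≫ pathMap ((toPSSet R).map j)) = b N Φ ≫ pathMap ((toPSSet R).map j)) :
    Z ⟶ (boundedMonad R κ).obj X :=
  adjHomEquiv R κ Z ((leftFunctor R κ).obj X).unop
    { app := fun N => Arrow.homMk ⟨b N, hb₀ N⟩ ⟨a N, ha₀ N⟩
        (Pointed.Hom.ext (funext fun Φ => hp N Φ))
      naturality := fun N N' j => by
        apply Arrow.hom_ext
        · exact Pointed.Hom.ext (funext fun Φ => hb N N' j.1 j.2 Φ)
        · exact Pointed.Hom.ext (funext fun φ => ha N N' j.1 j.2 φ) }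

lemma hatT_hom_ext {f g : Z ⟶ hatT R X}
    (h : ∀ i, f ≫ hatTProj i ≫ hatQFst i.rep = g ≫ hatTProj i ≫ hatQFst i.rep)
    (h' : ∀ i k, f ≫ hatTProj i ≫ hatQSnd i.rep k = g ≫ hatTProj i ≫ hatQSnd i.rep k) :
    f = g := by
  refine PSSet.hom_ext fun n z => funext fun i => Subtype.ext (Prod.ext ?_ (funext fun k => ?_))
  · exact PSSet.congr_app (h i) n z
  · exact PSSet.congr_app (h' i k) n z

lemma hatQ_condition (E : EffEpi R X) (k : EffNullClass E) :
    hatQSnd E k ≫ pathEnd _ = hatQFst E ≫ (toPSSet R).map k.rep.j :=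
  PSSet.hom_ext fun _ x => (congrFun x.2 k).symm

/-- The map to the modified dual Stover construction with given projections. -/
def hatTLift (a : ∀ i : EffEpiClass R X, Z ⟶ (toPSSet R).obj i.rep.M)
    (b : ∀ (i : EffEpiClass R X) (k : EffNullClass i.rep), Z ⟶ pathObj ((toPSSet R).obj k.rep.M'))
    (hp : ∀ i k, b i k ≫ pathEnd _ = a i ≫ (toPSSet R).map k.rep.j) : Z ⟶ hatT R X :=
  piLift fun i =>
    { app := fun n => ⟨fun z => ⟨(((a i).app n).toFun z, fun k => ((b i k).app n).toFun z),
          funext fun k => (PSSet.congr_app (hp i k) n z).symm⟩,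
        Subtype.ext (Prod.ext ((a i).app n).map_point
          (funext fun k => ((b i k).app n).map_point))⟩
      naturality := fun _ _ g => Pointed.Hom.ext (funext fun z => Subtype.ext (Prod.ext
        (congrFun (congrArg Pointed.Hom.toFun ((a i).naturality g)) z)
        (funext fun k => congrFun (congrArg Pointed.Hom.toFun ((b i k).naturality g)) z))) }

end UniversalProperties

/-! ### Factorisation through the chosen representatives -/

section Factorisation

variable {R : Type u} [CommRing R] {X : PSSet.{u}}

lemma EffEpi.exists_rep (E : EffEpi R X) : ∃ i : EffEpiClass R X, i.rep ≈ E := by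
  refine ⟨equivShrink _ (Quotient.mk _ E), ?_⟩
  rw [EffEpiClass.rep, Equiv.symm_apply_apply]
  exact Quotient.mk_out (s := EffEpi.setoid X) E

lemma EffEpiClass.rep_injective {i i' : EffEpiClass R X} (h : i.rep ≈ i'.rep) : i = i' :=
  (equivShrink _).symm.injective (Quotient.out_equiv_out.1 h)

lemma EffNull.exists_rep {E : EffEpi R X} (F : EffNull E) :
    ∃ k : EffNullClass E, k.rep ≈ F := by
  refine ⟨equivShrink _ (Quotient.mk _ F), ?_⟩
  rw [EffNullClass.rep, Equiv.symm_apply_apply]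
  exact Quotient.mk_out (s := EffNull.setoid E) F

lemma EffNullClass.rep_injective {E : EffEpi R X} {k k' : EffNullClass E} (h : k.rep ≈ k'.rep) :
    k = k' :=
  (equivShrink _).symm.injective (Quotient.out_equiv_out.1 h)

/-- Every map from `X` to a simplicial module factors through its image, hence through the chosen
representative of the isomorphism class of the corestriction to the image. -/
lemma exists_factor {N : SMod R} (φ : X ⟶ (toPSSet R).obj N) :
    ∃ (i : EffEpiClass R X) (j : i.rep.M ⟶ N), Mono j ∧ i.rep.φ ≫ (toPSSet R).map j = φ := by
  obtain ⟨i, e, he⟩ := EffEpi.exists_rep ⟨_, toIm φ, isEffEpi_toIm φ⟩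
  refine ⟨i, e.hom ≫ (hIm φ).ι, mono_comp _ _, ?_⟩
  rw [Functor.map_comp, ← Category.assoc, he, toIm_ι]

lemma factor_unique {N : SMod R} {i i' : EffEpiClass R X} {j : i.rep.M ⟶ N}
    {j' : i'.rep.M ⟶ N} [Mono j] [Mono j']
    (h : i.rep.φ ≫ (toPSSet R).map j = i'.rep.φ ≫ (toPSSet R).map j') :
    i = i' ∧ HEq j j' := by
  obtain ⟨e, he, -⟩ := IsEffEpi.exists_iso i.rep.eff i'.rep.eff j j' h
  obtain rfl := EffEpiClass.rep_injective ⟨e, he⟩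
  exact ⟨rfl, heq_of_eq (i.rep.eff.hom_ext h)⟩

/-- Every map from `X` to the path object of a simplicial module factors through one of the chosen
representatives. -/
lemma exists_pathFactor {N : SMod R} (Φ : X ⟶ pathObj ((toPSSet R).obj N)) :
    ∃ (i : EffEpiClass R X) (k : EffNullClass i.rep) (l : k.rep.M' ⟶ N),
      Mono l ∧ k.rep.Φ ≫ pathMap ((toPSSet R).map l) = Φ := by
  -- The endpoint of `Φ` is taken in the module generated by the image of the adjoint of `Φ`.
  obtain ⟨i, j, hj, h⟩ := exists_factor (toPathIm Φ ≫ pathEnd _)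
  obtain ⟨k, e, -, he⟩ := EffNull.exists_rep
    ⟨_, j, hj, toPathIm Φ, h.symm, isEffSurj_toPathIm Φ⟩
  refine ⟨i, k, e.hom ≫ (hIm (coneAdj Φ)).ι, mono_comp _ _, ?_⟩
  rw [Functor.map_comp, pathMap_comp, ← Category.assoc, he, toPathIm_ι]

lemma EffNull.null_comp {E : EffEpi R X} (F : EffNull E) {N : SMod R} (l : F.M' ⟶ N) :
    (F.Φ ≫ pathMap ((toPSSet R).map l)) ≫ pathEnd _ = E.φ ≫ (toPSSet R).map (F.j ≫ l) := by
  rw [Category.assoc, pathMap_pathEnd, ← Category.assoc, F.null, Category.assoc,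
    ← Functor.map_comp]

lemma pathFactor_unique {N : SMod R} {i i' : EffEpiClass R X} {k : EffNullClass i.rep}
    {k' : EffNullClass i'.rep} {l : k.rep.M' ⟶ N} {l' : k'.rep.M' ⟶ N} [Mono l] [Mono l']
    (h : k.rep.Φ ≫ pathMap ((toPSSet R).map l) = k'.rep.Φ ≫ pathMap ((toPSSet R).map l')) :
    i = i' ∧ HEq k k' ∧ HEq l l' := by
  have := k.rep.mono
  have := k'.rep.mono
  have : Mono (k.rep.j ≫ l) := mono_comp _ _
  have : Mono (k'.rep.j ≫ l') := mono_comp _ _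
  obtain ⟨rfl, -⟩ := factor_unique (j := k.rep.j ≫ l) (j' := k'.rep.j ≫ l')
    (by rw [← EffNull.null_comp, h, EffNull.null_comp])
  obtain ⟨e, he, -⟩ := IsEffSurj.exists_iso k.rep.eff k'.rep.eff l l' h
  -- The isomorphism respects the nullhomotopies, hence their endpoints; as `i.rep.φ` is an
  -- effective epimorphism, it then respects the monomorphisms from `i.rep.M`.
  have hj : k.rep.j ≫ e.hom = k'.rep.j := by
    refine i.rep.eff.hom_ext ?_
    rw [← EffNull.null_comp, he, k'.rep.null]
  obtain rfl := EffNullClass.rep_injective ⟨e, hj, he⟩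
  exact ⟨rfl, HEq.rfl, heq_of_eq (IsEffSurj.pathMap_ext k.rep.eff h)⟩

end Factorisation

/-! ### The comparison isomorphism -/

section Comparison

variable {R : Type u} [CommRing R] {X : PSSet.{u}} {κ : Cardinal.{u}}

/-- The map from the modified dual Stover construction to the simplicial module `N` indexed by
`φ : X ⟶ N`. -/
def hatTMap {N : SMod R} (φ : X ⟶ (toPSSet R).obj N) : hatT R X ⟶ (toPSSet R).obj N :=
  hatTProj (exists_factor φ).choose ≫ hatQFst _ ≫
    (toPSSet R).map (exists_factor φ).choose_spec.choose

lemma hatTMap_factor (i : EffEpiClass R X) {N : SMod R} (j : i.rep.M ⟶ N) [Mono j] :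
    hatTMap (i.rep.φ ≫ (toPSSet R).map j)
      = hatTProj i ≫ hatQFst i.rep ≫ (toPSSet R).map j := by
  have hs := (exists_factor (i.rep.φ ≫ (toPSSet R).map j)).choose_spec.choose_spec
  have key : ∀ (i' : EffEpiClass R X) (j' : i'.rep.M ⟶ N) (_ : i' = i ∧ HEq j' j),
      hatTProj i' ≫ hatQFst i'.rep ≫ (toPSSet R).map j'
        = hatTProj i ≫ hatQFst i.rep ≫ (toPSSet R).map j := by
    rintro _ _ ⟨rfl, h⟩
    rw [eq_of_heq h]
  have := hs.1
  exact key _ _ (factor_unique hs.2)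

/-- The map from the modified dual Stover construction to the path object of the simplicial
module `N` indexed by `Φ : X ⟶ P N`. -/
def hatTPathMap {N : SMod R} (Φ : X ⟶ pathObj ((toPSSet R).obj N)) :
    hatT R X ⟶ pathObj ((toPSSet R).obj N) :=
  hatTProj (exists_pathFactor Φ).choose ≫ hatQSnd _ (exists_pathFactor Φ).choose_spec.choose ≫
    pathMap ((toPSSet R).map (exists_pathFactor Φ).choose_spec.choose_spec.choose)

lemma hatTPathMap_factor (i : EffEpiClass R X) (k : EffNullClass i.rep) {N : SMod R}
    (l : k.rep.M' ⟶ N) [Mono l] :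
    hatTPathMap (k.rep.Φ ≫ pathMap ((toPSSet R).map l))
      = hatTProj i ≫ hatQSnd i.rep k ≫ pathMap ((toPSSet R).map l) := by
  have hs := (exists_pathFactor
    (k.rep.Φ ≫ pathMap ((toPSSet R).map l))).choose_spec.choose_spec.choose_spec
  have key : ∀ (i' : EffEpiClass R X) (k' : EffNullClass i'.rep) (l' : k'.rep.M' ⟶ N)
      (_ : i' = i ∧ HEq k' k ∧ HEq l' l),
      hatTProj i' ≫ hatQSnd i'.rep k' ≫ pathMap ((toPSSet R).map l')
        = hatTProj i ≫ hatQSnd i.rep k ≫ pathMap ((toPSSet R).map l) := by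
    rintro _ _ _ ⟨rfl, hk, h⟩
    obtain rfl := eq_of_heq hk
    rw [eq_of_heq h]
  have := hs.1
  exact key _ _ _ (pathFactor_unique hs.2)

lemma hatTMap_zeroMap (N : SMod R) : hatTMap (zeroMap X ((toPSSet R).obj N)) = zeroMap _ _ := by
  obtain ⟨i, j, hj, h⟩ := exists_factor (zeroMap X ((toPSSet R).obj N))
  rw [← h, hatTMap_factor, i.rep.eff.eq_zero h]
  exact PSSet.hom_ext fun _ _ => rfl

lemma hatTPathMap_zeroMap (N : SMod R) :
    hatTPathMap (zeroMap X (pathObj ((toPSSet R).obj N))) = zeroMap _ _ := by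
  obtain ⟨i, k, l, hl, h⟩ := exists_pathFactor (zeroMap X (pathObj ((toPSSet R).obj N)))
  rw [← h, hatTPathMap_factor, IsEffSurj.eq_zero k.rep.eff h]
  refine PSSet.hom_ext fun n x => Subtype.ext (NatTrans.ext (funext fun m => ?_))
  ext a
  exact (map_point ((toPSSet R).obj N) _).symm

lemma hatTMap_comp {N N' : SMod R} (φ : X ⟶ (toPSSet R).obj N) (j : N ⟶ N') [Mono j] :
    hatTMap (φ ≫ (toPSSet R).map j) = hatTMap φ ≫ (toPSSet R).map j := by
  obtain ⟨i, j', hj', rfl⟩ := exists_factor φ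
  have : Mono (j' ≫ j) := mono_comp _ _
  rw [hatTMap_factor, Category.assoc, ← Functor.map_comp, hatTMap_factor]
  simp only [Category.assoc, Functor.map_comp]

lemma hatTPathMap_comp {N N' : SMod R} (Φ : X ⟶ pathObj ((toPSSet R).obj N)) (j : N ⟶ N')
    [Mono j] : hatTPathMap (Φ ≫ pathMap ((toPSSet R).map j))
      = hatTPathMap Φ ≫ pathMap ((toPSSet R).map j) := by
  obtain ⟨i, k, l, hl, rfl⟩ := exists_pathFactor Φ
  have : Mono (l ≫ j) := mono_comp _ _
  rw [hatTPathMap_factor, Category.assoc, ← pathMap_comp, ← Functor.map_comp,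
    hatTPathMap_factor]
  simp only [Category.assoc, Functor.map_comp, pathMap_comp]

lemma hatTPathMap_pathEnd {N : SMod R} (Φ : X ⟶ pathObj ((toPSSet R).obj N)) :
    hatTPathMap Φ ≫ pathEnd _ = hatTMap (Φ ≫ pathEnd _) := by
  obtain ⟨i, k, l, hl, rfl⟩ := exists_pathFactor Φ
  have := k.rep.mono
  have : Mono (k.rep.j ≫ l) := mono_comp _ _
  rw [EffNull.null_comp, hatTPathMap_factor, hatTMap_factor, Category.assoc, Category.assoc,
    pathMap_pathEnd, ← Category.assoc (hatQSnd _ _), hatQ_condition, Category.assoc,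
    ← Functor.map_comp]

variable (R X κ)

/-- The comparison map from the modified dual Stover construction to the bounded monad. -/
def comparison : hatT R X ⟶ (boundedMonad R κ).obj X :=
  monadLift (fun _ φ => hatTMap φ) (fun _ Φ => hatTPathMap Φ) (fun _ => hatTMap_zeroMap _)
    (fun _ => hatTPathMap_zeroMap _) (fun _ Φ => hatTPathMap_pathEnd Φ)
    (fun _ _ j _ φ => hatTMap_comp φ j) (fun _ _ j _ Φ => hatTPathMap_comp Φ j)

variable {R X κ}

lemma comparison_monadProj (N : BddMod R κ) (φ : X ⟶ (toPSSet R).obj N.toSMod) :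
    comparison R X κ ≫ monadProj N φ = hatTMap φ := rfl

lemma comparison_monadPathProj (N : BddMod R κ) (Φ : X ⟶ pathObj ((toPSSet R).obj N.toSMod)) :
    comparison R X κ ≫ monadPathProj N Φ = hatTPathMap Φ := rfl

/-- The projection of the bounded monad at `X` indexed by a map to a simplicial module `M` with
at most `κ` simplices, not necessarily in the chosen small category. -/
def monadMap {M : SMod R} (hM : Cardinal.mk (Simplices ((toPSSet R).obj M)) ≤ κ)
    (φ : X ⟶ (toPSSet R).obj M) : (boundedMonad R κ).obj X ⟶ (toPSSet R).obj M :=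
  monadProj (BddMod.exists_iso M hM).choose
      (φ ≫ (toPSSet R).map (BddMod.exists_iso M hM).choose_spec.some.hom) ≫
    (toPSSet R).map (BddMod.exists_iso M hM).choose_spec.some.inv

lemma monadMap_comp {M : SMod R} (hM : Cardinal.mk (Simplices ((toPSSet R).obj M)) ≤ κ)
    (φ : X ⟶ (toPSSet R).obj M) {N : BddMod R κ} (j : M ⟶ N.toSMod) [Mono j] :
    monadMap hM φ ≫ (toPSSet R).map j = monadProj N (φ ≫ (toPSSet R).map j) := by
  have : Mono ((BddMod.exists_iso M hM).choose_spec.some.inv ≫ j) := mono_comp _ _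
  rw [monadMap, Category.assoc, ← Functor.map_comp, ← monadProj_naturality, Category.assoc,
    ← Functor.map_comp, Iso.hom_inv_id_assoc]

lemma comparison_monadMap {M : SMod R} (hM : Cardinal.mk (Simplices ((toPSSet R).obj M)) ≤ κ)
    (φ : X ⟶ (toPSSet R).obj M) : comparison R X κ ≫ monadMap hM φ = hatTMap φ := by
  rw [monadMap, ← Category.assoc, comparison_monadProj, ← hatTMap_comp, Category.assoc,
    ← Functor.map_comp, Iso.hom_inv_id, CategoryTheory.Functor.map_id, Category.comp_id]

/-- The projection of the bounded monad at `X` indexed by a map to the path object of a simplicial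
module `M` with at most `κ` simplices, not necessarily in the chosen small category. -/
def monadPathMap {M : SMod R} (hM : Cardinal.mk (Simplices ((toPSSet R).obj M)) ≤ κ)
    (Φ : X ⟶ pathObj ((toPSSet R).obj M)) :
    (boundedMonad R κ).obj X ⟶ pathObj ((toPSSet R).obj M) :=
  monadPathProj (BddMod.exists_iso M hM).choose
      (Φ ≫ pathMap ((toPSSet R).map (BddMod.exists_iso M hM).choose_spec.some.hom)) ≫
    pathMap ((toPSSet R).map (BddMod.exists_iso M hM).choose_spec.some.inv)

lemma monadPathMap_comp {M : SMod R} (hM : Cardinal.mk (Simplices ((toPSSet R).obj M)) ≤ κ)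
    (Φ : X ⟶ pathObj ((toPSSet R).obj M)) {N : BddMod R κ} (j : M ⟶ N.toSMod) [Mono j] :
    monadPathMap hM Φ ≫ pathMap ((toPSSet R).map j)
      = monadPathProj N (Φ ≫ pathMap ((toPSSet R).map j)) := by
  have : Mono ((BddMod.exists_iso M hM).choose_spec.some.inv ≫ j) := mono_comp _ _
  rw [monadPathMap, Category.assoc, ← pathMap_comp, ← Functor.map_comp,
    ← monadPathProj_naturality, Category.assoc, ← pathMap_comp, ← Functor.map_comp,
    Iso.hom_inv_id_assoc]

lemma comparison_monadPathMap {M : SMod R}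
    (hM : Cardinal.mk (Simplices ((toPSSet R).obj M)) ≤ κ)
    (Φ : X ⟶ pathObj ((toPSSet R).obj M)) :
    comparison R X κ ≫ monadPathMap hM Φ = hatTPathMap Φ := by
  rw [monadPathMap, ← Category.assoc, comparison_monadPathProj, ← hatTPathMap_comp,
    Category.assoc, ← pathMap_comp, ← Functor.map_comp, Iso.hom_inv_id, CategoryTheory.Functor.map_id,
    pathMap_id, Category.comp_id]

lemma monadPathMap_pathEnd {M M' : SMod R}
    (hM : Cardinal.mk (Simplices ((toPSSet R).obj M)) ≤ κ)
    (hM' : Cardinal.mk (Simplices ((toPSSet R).obj M')) ≤ κ)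
    {φ : X ⟶ (toPSSet R).obj M} {Φ : X ⟶ pathObj ((toPSSet R).obj M')} {j : M ⟶ M'} [Mono j]
    (h : Φ ≫ pathEnd _ = φ ≫ (toPSSet R).map j) :
    monadPathMap hM' Φ ≫ pathEnd _ = monadMap hM φ ≫ (toPSSet R).map j := by
  obtain ⟨N, ⟨e⟩⟩ := BddMod.exists_iso M' hM'
  have : Mono (j ≫ e.hom) := mono_comp _ _
  rw [← cancel_mono ((toPSSet R).map e.hom), Category.assoc, ← pathMap_pathEnd,
    ← Category.assoc, monadPathMap_comp, monadPathProj_pathEnd, Category.assoc,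
    pathMap_pathEnd, ← Category.assoc, h, Category.assoc, Category.assoc, ← Functor.map_comp,
    monadMap_comp]

/-- The inverse of the comparison map, for `κ ≥ λ_X`. -/
def comparisonInv (hκ : lambdaCard R X ≤ κ) : (boundedMonad R κ).obj X ⟶ hatT R X :=
  hatTLift (fun i => monadMap (i.rep.eff.mk_le_of_lambdaCard_le hκ) i.rep.φ)
    (fun _ k => monadPathMap (IsEffSurj.mk_le_of_lambdaCard_le hκ k.rep.eff) k.rep.Φ)
    (fun _ k => haveI := k.rep.mono; monadPathMap_pathEnd _ _ k.rep.null)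

lemma comparisonInv_fst (hκ : lambdaCard R X ≤ κ) (i : EffEpiClass R X) :
    comparisonInv hκ ≫ hatTProj i ≫ hatQFst i.rep
      = monadMap (i.rep.eff.mk_le_of_lambdaCard_le hκ) i.rep.φ := rfl

lemma comparisonInv_snd (hκ : lambdaCard R X ≤ κ) (i : EffEpiClass R X)
    (k : EffNullClass i.rep) : comparisonInv hκ ≫ hatTProj i ≫ hatQSnd i.rep k
      = monadPathMap (IsEffSurj.mk_le_of_lambdaCard_le hκ k.rep.eff) k.rep.Φ := rfl

/-- The comparison isomorphism. -/
def comparisonIso (hκ : lambdaCard R X ≤ κ) : hatT R X ≅ (boundedMonad R κ).obj X where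
  hom := comparison R X κ
  inv := comparisonInv hκ
  hom_inv_id := by
    refine hatT_hom_ext (fun i => ?_) (fun i k => ?_)
    · rw [Category.assoc, comparisonInv_fst, comparison_monadMap, Category.id_comp]
      simpa using hatTMap_factor i (𝟙 _)
    · rw [Category.assoc, comparisonInv_snd, comparison_monadPathMap, Category.id_comp]
      have h := hatTPathMap_factor i k (𝟙 _)
      rwa [CategoryTheory.Functor.map_id, pathMap_id, Category.comp_id, Category.comp_id] at h
  inv_hom_id := by
    refine boundedMonad_hom_ext (fun N φ => ?_) (fun N Φ => ?_)
    · obtain ⟨i, j, hj, rfl⟩ := exists_factor φ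
      rw [Category.assoc, comparison_monadProj, hatTMap_factor, Category.id_comp,
        ← Category.assoc (hatTProj i), ← Category.assoc, comparisonInv_fst, monadMap_comp]
    · obtain ⟨i, k, l, hl, rfl⟩ := exists_pathFactor Φ
      rw [Category.assoc, comparison_monadPathProj, hatTPathMap_factor, Category.id_comp,
        ← Category.assoc (hatTProj i), ← Category.assoc, comparisonInv_snd, monadPathMap_comp]

end Comparison

end

end DualStover

open DualStover in
/-- For `κ ≥ λ_X` there is a unique isomorphism from the modified dual Stover construction to the
bounded monad at `X` which is compatible with the projections to the modules and to their path
objects. -/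
theorem proposition4p9 {R : Type u} [CommRing R] (X : PSSet.{u}) (κ : Cardinal.{u})
    (hκ : lambdaCard R X ≤ κ) :
    ∃! e : hatT R X ≅ (boundedMonad R κ).obj X,
      (∀ (i : EffEpiClass R X) (N : BddMod R κ) (j : i.rep.M ⟶ N.toSMod), Mono j →
        e.hom ≫ monadProj N (i.rep.φ ≫ (toPSSet R).map j)
          = hatTProj i ≫ hatQFst i.rep ≫ (toPSSet R).map j) ∧
      (∀ (i : EffEpiClass R X) (k : EffNullClass i.rep) (N : BddMod R κ)
        (l : k.rep.M' ⟶ N.toSMod), Mono l →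
        e.hom ≫ monadPathProj N (k.rep.Φ ≫ pathMap ((toPSSet R).map l))
          = hatTProj i ≫ hatQSnd i.rep k ≫ pathMap ((toPSSet R).map l)) := by
  refine ⟨comparisonIso hκ, ⟨fun i N j hj => hatTMap_factor i j,
    fun i k N l hl => hatTPathMap_factor i k l⟩, ?_⟩
  rintro e ⟨h, h'⟩
  apply Iso.ext
  refine boundedMonad_hom_ext (fun N φ => ?_) (fun N Φ => ?_)
  · obtain ⟨i, j, hj, rfl⟩ := exists_factor φ
    exact (h i N j hj).trans (hatTMap_factor i j).symm
  · obtain ⟨i, k, l, hl, rfl⟩ := exists_pathFactor Φ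
    exact (h' i k N l hl).trans (hatTPathMap_factor i k l).symm
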